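/- Let $\mathbb{X}$ and $\Theta$ be Polish spaces with their Borel $\sigma$-fields, and let $(\Omega,\mathscr{F},\mathbb{P})$ be a probability space. Let $\{W_n,n\ge1\}$ be independent real random variables with $W_1=1$ almost surely and $W_n\sim\mathrm{Beta}(1,n-1)$ for $n\ge2$, and let $\{\vartheta_n,n\ge1\}$ be an exchangeable sequence of $\Theta$-valued random variables, independent of $\{W_n,n\ge1\}$. Define random measures on $\Theta$ by $$Q_n=W_n\delta_{\vartheta_n}+(1-W_n)Q_{n-1},\qquad n\ge1$$ (no initial value $Q_0$ matters, since $W_1=1$ almost surely). Let $\lambda$ be a $\sigma$-finite measure on $\mathbb{X}$ and let $k:\mathbb{X}\times\Theta\to[0,\infty)$ be measurable, such that $x\mapsto k(x,\vartheta)$ is a probability density with respect to $\lambda$ for every $\vartheta\in\Theta$. Suppose that $\vartheta\mapsto k(x,\vartheta)$ is continuous for every $x\in\mathbb{X}$ and that there is a $\lambda$-integrable function $h$ with $k(x,\vartheta)\le h(x)$ for all $x\in\mathbb{X}$ and $\vartheta\in\Theta$. Then there is a random probability measure $Q$ on $\Theta$, defined on $(\Omega,\mathscr{F},\mathbb{P})$,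 such that $Q_n$ converges weakly to $Q$ almost surely, and whose law is the de Finetti measure of $\{\vartheta_n\}$, i.e. $\mathbb{P}(\vartheta_1\in A_1,\dots,\vartheta_n\in A_n)=\mathbb{E}\big[\prod_{i=1}^nQ(A_i)\big]$ for all $n$ and all Borel sets $A_1,\dots,A_n\subseteq\Theta$. Moreover, for every random probability measure $Q$ on $\Theta$ to which $Q_n$ converges weakly almost surely, the functions $$f_n(x)=\int_\Theta k(x,\vartheta)\,Q_n(\mathrm{d}\vartheta),\qquad f(x)=\int_\Theta k(x,\vartheta)\,Q(\mathrm{d}\vartheta)$$ are almost surely $\lambda$-integrable for all $n\ge1$, and $$\lim_{n\to\infty}\int_{\mathbb{X}}|f_n(x)-f(x)|\,\lambda(\mathrm{d}x)=0\qquad\text{almost surely.}$$ -/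

import Mathlib

open MeasureTheory ProbabilityTheory Filter Topology
open scoped NNReal ENNReal

noncomputable section

/-- A sequence of random variables is exchangeable: for every `n` and every permutation `σ` of
the first `n` indices, `(Z_{σ(1)}, …, Z_{σ(n)})` and `(Z_1, …, Z_n)` have the same law. -/
def Exchangeable {Ω Θ : Type*} [MeasurableSpace Ω] [MeasurableSpace Θ]
    (P : Measure Ω) (Z : ℕ → Ω → Θ) : Prop :=
  ∀ (n : ℕ) (σ : Equiv.Perm (Fin n)),
    P.map (fun ω (i : Fin n) => Z (σ i) ω) = P.map (fun ω (i : Fin n) => Z i ω)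

/-- `ν`, a law on the space of probability measures on `Θ`, is the de Finetti measure of the
sequence `Z`: the finite-dimensional laws of `Z` are the `ν`-mixtures of i.i.d. laws,
`P(Z_1 ∈ A_1, …, Z_n ∈ A_n) = ∫ p(A_1) ⋯ p(A_n) ν(dp)`. -/
def IsDeFinettiMeasure {Ω Θ : Type*} [MeasurableSpace Ω] [MeasurableSpace Θ]
    (P : Measure Ω) (Z : ℕ → Ω → Θ) (ν : Measure (ProbabilityMeasure Θ)) : Prop :=
  IsProbabilityMeasure ν ∧
    ∀ (n : ℕ) (A : Fin n → Set Θ), (∀ i, MeasurableSet (A i)) →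
      P {ω | ∀ i : Fin n, Z i ω ∈ A i} = ∫⁻ p, ∏ i : Fin n, (p : Measure Θ) (A i) ∂ν

/-- The measure-valued chain `Q_n = W_n δ_{Z_n} + (1 - W_n) Q_{n-1}`, `n ≥ 1`, at one outcome.
The `n`-th weight and the `n`-th atom (`n ≥ 1`) are `w (n - 1)` and `z (n - 1)`. There is no
initial state to choose, since the first weight is `1`; the empty sum `0` is put there. For
weights in `[0, 1]` the truncation to nonnegative reals does nothing. -/
def chainQ {Θ : Type*} [MeasurableSpace Θ] (w : ℕ → ℝ) (z : ℕ → Θ) : ℕ → FiniteMeasure Θ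
  | 0 => 0
  | n + 1 => (w n).toNNReal • (diracProba (z n)).toFiniteMeasure
      + (1 - w n).toNNReal • chainQ w z n

/-- The weights of the chain: independent, `W_1 = 1` almost surely and `W_n ∼ Beta(1, n - 1)` for
`n ≥ 2`, where `W_n` is `W (n - 1)`. -/
structure IsChainWeights {Ω : Type*} [MeasurableSpace Ω] (P : Measure Ω) (W : ℕ → Ω → ℝ) :
    Prop where
  measurable : ∀ n, Measurable (W n)
  indep : iIndepFun W P
  first : ∀ᵐ ω ∂P, W 0 ω = 1
  beta : ∀ n : ℕ, 1 ≤ n → P.map (W n) = betaMeasure 1 n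

/-- `Q` is a random probability measure to which the chain converges weakly, almost surely. -/
def IsWeakLimit {Ω Θ : Type*} [MeasurableSpace Ω] [TopologicalSpace Θ] [MeasurableSpace Θ]
    [OpensMeasurableSpace Θ] (P : Measure Ω) (W : ℕ → Ω → ℝ) (Z : ℕ → Ω → Θ)
    (Q : Ω → ProbabilityMeasure Θ) : Prop :=
  Measurable Q ∧
    ∀ᵐ ω ∂P, Tendsto (fun n => chainQ (fun i => W i ω) (fun i => Z i ω) n) atTop
      (𝓝 (Q ω).toFiniteMeasure)

/-- `k` is a kernel of densities with respect to `μ`: nonnegative, jointly measurable, and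
`x ↦ k x θ` is a probability density with respect to `μ` for every `θ`. -/
structure IsDensityKernel {X Θ : Type*} [MeasurableSpace X] [MeasurableSpace Θ]
    (μ : Measure X) (k : X → Θ → ℝ) : Prop where
  nonneg : ∀ x θ, 0 ≤ k x θ
  measurable : Measurable (Function.uncurry k)
  density : ∀ θ, ∫⁻ x, ENNReal.ofReal (k x θ) ∂μ = 1

/-- The mixture `x ↦ ∫ k(x, θ) q(dθ)`. -/
def mixture {X Θ : Type*} [MeasurableSpace Θ] (k : X → Θ → ℝ) (q : Measure Θ) (x : X) : ℝ :=
  ∫ θ, k x θ ∂q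

end

/-! Everything rests on one fact: there is a random probability measure `q`, a function of the
sequence `Z`, such that for each Borel `A` the residuals `1_A(Z_i) - q(A)` are pairwise orthogonal
in L². To get it, `q` is taken to be a conditional law of `Z_0` given the events invariant under all
swaps `(0 j)`. Exchangeability makes the Gram matrix of the indicators constant on and off the
diagonal, so their averages converge in L² to some `L` with orthogonal residuals
(`exists_tendsto_average_of_inner_eq`). This `L` is a swap-invariant limit of frequencies with the
right integrals over invariant events, hence equals `q(A)` (`Exchangeable.exists_directing`).

Orthogonality is then used twice. It gives averages of indicators an L¹ error of order `n^(-1/2)`,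
and products of averages over disjoint blocks yield the mixture representation
(`Exchangeable.integral_prod_indicator_eq`). It also controls the error `D_n = Q_n(A) - q(A)`, which
satisfies `D_{n+1} = (1 - V_n) D_n + V_n Y_n` with `V_n` the weight and `Y_n` the residual: the
cross terms vanish, and the beta moments give `E D_n² ≤ 2/(n+1)` for `n ≥ 1`
(`integral_sq_le_of_recursion`). Convergence along squares, with control of the gaps between them,
makes this almost sure (`ae_tendsto_zero_of_integral_sq_le`). A countable π-system of open sets
upgrades this to weak convergence.

The L¹ statement is pathwise: `k(x, ·)` is a bounded continuous test function, and `h` permits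
dominated convergence in `x`. -/

/-! ### Averages of an exchangeable family in a Hilbert space -/

section Hilbert

variable {H : Type*} [NormedAddCommGroup H] [InnerProductSpace ℝ H]

theorem inner_limit_of_inner_eq_const {x : ℕ → H} {L v : H} {d : ℝ}
    (hL : Tendsto (fun n : ℕ => ((n : ℝ) + 1)⁻¹ • ∑ i ∈ Finset.range (n + 1), x i) atTop (𝓝 L))
    (hv : ∀ j, inner ℝ v (x j) = d) : inner ℝ v L = d := by
  refine tendsto_nhds_unique ((tendsto_const_nhds (x := v)).inner (𝕜 := ℝ) hL)
    (tendsto_const_nhds.congr fun n => ?_)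
  simp only [inner_smul_right, inner_sum, hv, Finset.sum_const, Finset.card_range, nsmul_eq_mul]
  push_cast
  field_simp

/-- For `n ≤ m` the averages satisfy `⟨A_n, A_m⟩ = b + (a - b)/(m + 1)`, hence `‖A_n - A_m‖² ≤ (a -
b)/(n + 1)` and they are Cauchy. In the limit `⟨x_i, L⟩ = ⟨L, L⟩ = b`, so off the diagonal the
residuals pair to `b - b - b + b = 0`. -/
theorem exists_tendsto_average_of_inner_eq [CompleteSpace H] {x : ℕ → H} {a b : ℝ}
    (hx : ∀ i j, inner ℝ (x i) (x j) = if i = j then a else b) :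
    ∃ L : H,
      Tendsto (fun n : ℕ => ((n : ℝ) + 1)⁻¹ • ∑ i ∈ Finset.range (n + 1), x i) atTop (𝓝 L) ∧
      ∀ i j, i ≠ j → inner ℝ (x i - L) (x j - L) = 0 := by
  set A : ℕ → H := fun n : ℕ => ((n : ℝ) + 1)⁻¹ • ∑ i ∈ Finset.range (n + 1), x i with hA
  have hxA : ∀ i n, i ≤ n → inner ℝ (x i) (A n) = b + (a - b) / (n + 1) := by
    intro i n hin
    have h1 : ∀ j ∈ Finset.range (n + 1),
        inner ℝ (x i) (x j) = b + if i = j then (a - b) else 0 := by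
      intro j _
      rw [hx]; split_ifs <;> ring
    have hi : i < n + 1 := by omega
    simp only [hA, inner_smul_right, inner_sum]
    rw [Finset.sum_congr rfl h1, Finset.sum_add_distrib, Finset.sum_ite_eq]
    simp only [Finset.sum_const, Finset.card_range, nsmul_eq_mul, Finset.mem_range, hi, if_true]
    push_cast
    field_simp
  have hAA : ∀ n m, n ≤ m → inner ℝ (A n) (A m) = b + (a - b) / (m + 1) := by
    intro n m hnm
    have h1 : ∀ j ∈ Finset.range (n + 1), inner ℝ (x j) (A m) = b + (a - b) / (m + 1) := by
      intro j hj
      exact hxA j m (by have := Finset.mem_range.1 hj; omega)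
    nth_rewrite 1 [hA]
    simp only [inner_smul_left, sum_inner]
    rw [Finset.sum_congr rfl h1]
    simp only [Finset.sum_const, Finset.card_range, nsmul_eq_mul]
    push_cast
    simp
    field_simp
  have hab : 0 ≤ a - b := by
    have h := real_inner_self_nonneg (x := x 0 - x 1)
    simp only [inner_sub_left, inner_sub_right, hx] at h
    norm_num at h
    linarith
  have hdist : ∀ n m, n ≤ m → dist (A n) (A m) ≤ Real.sqrt ((a - b) / (n + 1)) := by
    intro n m hnm
    rw [dist_eq_norm]
    apply Real.le_sqrt_of_sq_le
    rw [← real_inner_self_eq_norm_sq, inner_sub_left, inner_sub_right, inner_sub_right,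
      real_inner_comm (A n) (A m), hAA n m hnm, hAA n n le_rfl, hAA m m le_rfl]
    have : 0 ≤ (a - b) / ((m : ℝ) + 1) := by positivity
    linarith
  have hlim : Tendsto (fun n : ℕ => Real.sqrt ((a - b) / (n + 1))) atTop (𝓝 0) := by
    have : Tendsto (fun n : ℕ => (a - b) / ((n : ℝ) + 1)) atTop (𝓝 0) :=
      tendsto_const_nhds.div_atTop (tendsto_natCast_atTop_atTop.atTop_add tendsto_const_nhds)
    simpa using this.sqrt
  have hcau : CauchySeq A := by
    refine cauchySeq_of_le_tendsto_0' _ (fun n m hnm => hdist n m hnm) hlim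
  obtain ⟨L, hL⟩ := cauchySeq_tendsto_of_complete hcau
  have hxL : ∀ i, inner ℝ (x i) L = b := by
    intro i
    have h1 : Tendsto (fun n => inner ℝ (x i) (A n)) atTop (𝓝 (inner ℝ (x i) L)) :=
      tendsto_const_nhds.inner hL
    have h2 : Tendsto (fun n : ℕ => b + (a - b) / ((n : ℝ) + 1)) atTop (𝓝 (b + 0)) :=
      tendsto_const_nhds.add
        (tendsto_const_nhds.div_atTop (tendsto_natCast_atTop_atTop.atTop_add tendsto_const_nhds))
    rw [add_zero] at h2
    refine tendsto_nhds_unique h1 (h2.congr' ?_)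
    filter_upwards [eventually_ge_atTop i] with n hn
    exact (hxA i n hn).symm
  have hLL : inner ℝ L L = b :=
    inner_limit_of_inner_eq_const hL fun j => by rw [real_inner_comm, hxL]
  refine ⟨L, hL, fun i j hij => ?_⟩
  rw [inner_sub_left, inner_sub_right, inner_sub_right, hx, if_neg hij, hxL, hLL,
    real_inner_comm, hxL]
  ring

end Hilbert

/-! ### Exchangeability along arbitrary injective index maps -/

section Exchangeable

variable {Ω Θ : Type*} [MeasurableSpace Ω] [MeasurableSpace Θ] {P : Measure Ω} {Z : ℕ → Ω → Θ}

theorem Exchangeable.map_injective_eq_fin (hZ : Exchangeable P Z) (hm : ∀ n, Measurable (Z n))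
    {r : ℕ} (e : Fin r → ℕ) (he : Function.Injective e) :
    P.map (fun ω i => Z (e i) ω) = P.map (fun ω (i : Fin r) => Z i ω) := by
  obtain ⟨N, hrN, heN⟩ : ∃ N, r ≤ N ∧ ∀ i, e i < N := by
    refine ⟨r + ∑ i, (e i + 1), by omega, fun i => ?_⟩
    have := Finset.single_le_sum (f := fun i => e i + 1) (fun _ _ => Nat.zero_le _)
      (Finset.mem_univ i)
    omega
  -- Only the values on the first `r` indices matter: `f` is injective there, and that restriction
  -- extends to a permutation of `Fin N`.
  let f : Fin N → Fin N := fun k => if h : (k : ℕ) < r then ⟨e ⟨k, h⟩, heN _⟩ else k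
  obtain ⟨g, hg⟩ := Finset.exists_equiv_extend_of_card_eq (α := Fin N) (β := Fin N)
    (t := Finset.univ) (by simp) (s := Finset.univ.filter (fun k : Fin N => (k : ℕ) < r))
    (f := f) (Finset.subset_univ _) (by
      intro k hk l hl hkl
      simp only [Finset.coe_filter, Finset.mem_univ, true_and, Set.mem_ofPred_eq] at hk hl
      simp only [f, hk, hl, dif_pos, Fin.mk.injEq] at hkl
      have := he hkl
      simp only [Fin.mk.injEq] at this
      exact Fin.ext this)
  let σ : Equiv.Perm (Fin N) := g.trans (Equiv.subtypeUnivEquiv (by simp))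
  have hσ : ∀ i : Fin r, ((σ (Fin.castLE hrN i) : Fin N) : ℕ) = e i := by
    intro i
    have h1 := hg (Fin.castLE hrN i) (by simp)
    simp only [σ, Equiv.trans_apply, Equiv.subtypeUnivEquiv_apply, h1]
    simp [f]
  have h := congrArg (Measure.map (fun (v : Fin N → Θ) (i : Fin r) => v (Fin.castLE hrN i))) (hZ N σ)
  rw [Measure.map_map (by fun_prop) (by fun_prop), Measure.map_map (by fun_prop) (by fun_prop)] at h
  simpa [Function.comp_def, hσ] using h

theorem Exchangeable.map_injective_eq {ι : Type*} [Finite ι] (hZ : Exchangeable P Z)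
    (hm : ∀ n, Measurable (Z n)) (e e' : ι → ℕ) (he : Function.Injective e)
    (he' : Function.Injective e') :
    P.map (fun ω i => Z (e i) ω) = P.map (fun ω i => Z (e' i) ω) := by
  obtain ⟨r, ⟨u⟩⟩ := Finite.exists_equiv_fin ι
  have h := (hZ.map_injective_eq_fin hm _ (he.comp u.symm.injective)).trans
    (hZ.map_injective_eq_fin hm _ (he'.comp u.symm.injective)).symm
  have h := congrArg (Measure.map (fun (v : Fin r → Θ) (i : ι) => v (u i))) h
  rw [Measure.map_map (by fun_prop) (by fun_prop), Measure.map_map (by fun_prop) (by fun_prop)] at h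
  simpa [Function.comp_def] using h

/-- The law of the whole sequence is determined by its finite-dimensional marginals, and these agree
because a permutation is injective on each finite index set. -/
theorem Exchangeable.map_comp_perm [IsFiniteMeasure P] (hZ : Exchangeable P Z)
    (hm : ∀ n, Measurable (Z n)) (σ : Equiv.Perm ℕ) :
    P.map (fun ω n => Z (σ n) ω) = P.map (fun ω n => Z n ω) := by
  refine IsProjectiveLimit.unique (P := fun I : Finset ℕ => P.map (fun ω (i : I) => Z i ω)) ?_ ?_
  · intro I
    rw [Measure.map_map (by fun_prop) (by fun_prop)]
    exact hZ.map_injective_eq hm (fun i : I => σ i) (fun i : I => i)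
      (σ.injective.comp Subtype.val_injective) Subtype.val_injective
  · intro I
    rw [Measure.map_map (by fun_prop) (by fun_prop)]
    rfl

end Exchangeable

/-! ### The directing random measure -/

section Directing

variable {Ω Θ : Type*} [MeasurableSpace Ω] [MeasurableSpace Θ]

/-- The σ-algebra of measurable sets of sequences that are invariant under all transpositions
`(0 j)`. -/
abbrev swapInvariants (Θ : Type*) [MeasurableSpace Θ] : MeasurableSpace (ℕ → Θ) where
  MeasurableSet' B := MeasurableSet B ∧
    ∀ j, (fun (z : ℕ → Θ) n => z (Equiv.swap 0 j n)) ⁻¹' B = B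
  measurableSet_empty := ⟨.empty, fun _ => rfl⟩
  measurableSet_compl B hB := ⟨hB.1.compl, fun j => by rw [Set.preimage_compl, hB.2]⟩
  measurableSet_iUnion f hf := ⟨.iUnion fun i => (hf i).1, fun j => by
    rw [Set.preimage_iUnion]; exact Set.iUnion_congr fun i => (hf i).2 j⟩

theorem swapInvariants_le : swapInvariants Θ ≤ MeasurableSpace.pi := fun _ h => h.1

theorem measurable_swapInvariants {F : (ℕ → Θ) → ℝ} (hF : Measurable F)
    (hinv : ∀ j z, F (fun n => z (Equiv.swap 0 j n)) = F z) :
    Measurable[swapInvariants Θ] F := by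
  intro s hs
  refine ⟨hF hs, fun j => ?_⟩
  ext z
  simp only [Set.mem_preimage, hinv]

/-- The frequency of visits to `A` along the first `n + 1` terms of a sequence. -/
noncomputable def frequency (A : Set Θ) (z : ℕ → Θ) (n : ℕ) : ℝ :=
  ((n : ℝ) + 1)⁻¹ * ∑ i ∈ Finset.range (n + 1), A.indicator 1 (z i)

@[fun_prop]
theorem measurable_frequency {A : Set Θ} (hA : MeasurableSet A) (n : ℕ) :
    Measurable fun z : ℕ → Θ => frequency A z n := by
  have : Measurable (A.indicator (1 : Θ → ℝ)) := measurable_one.indicator hA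
  unfold frequency
  fun_prop

omit [MeasurableSpace Θ] in
theorem frequency_swap (A : Set Θ) (z : ℕ → Θ) {n j : ℕ} (hj : j ≤ n) :
    frequency A (fun n => z (Equiv.swap 0 j n)) n = frequency A z n := by
  unfold frequency
  congr 1
  refine Equiv.Perm.sum_comp (Equiv.swap 0 j) (Finset.range (n + 1))
    (fun i => A.indicator (1 : Θ → ℝ) (z i)) fun i hi => ?_
  have hi : Equiv.swap 0 j i ≠ i := hi
  by_contra h
  simp only [Finset.coe_range, Set.mem_Iio] at h
  exact hi (Equiv.swap_apply_of_ne_of_ne (by omega) (by omega))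

variable {P : Measure Ω} [IsProbabilityMeasure P] {Z : ℕ → Ω → Θ}

theorem memLp_indicator_comp {A : Set Θ} (hA : MeasurableSet A) {Y : Ω → Θ} (hY : Measurable Y)
    (p : ℝ≥0∞) : MemLp (fun ω => A.indicator (1 : Θ → ℝ) (Y ω)) p P := by
  refine MemLp.of_bound ((measurable_one.indicator hA).comp hY).aestronglyMeasurable 1
    (.of_forall fun ω => ?_)
  by_cases h : Y ω ∈ A <;> simp [h]

omit [IsProbabilityMeasure P] in
theorem Exchangeable.integral_indicator_mul (hZ : Exchangeable P Z) (hm : ∀ n, Measurable (Z n))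
    {A : Set Θ} (hA : MeasurableSet A) (i j : ℕ) :
    ∫ ω, A.indicator (1 : Θ → ℝ) (Z i ω) * A.indicator (1 : Θ → ℝ) (Z j ω) ∂P =
      if i = j then ∫ ω, A.indicator (1 : Θ → ℝ) (Z 0 ω) ∂P
      else ∫ ω, A.indicator (1 : Θ → ℝ) (Z 0 ω) * A.indicator (1 : Θ → ℝ) (Z 1 ω) ∂P := by
  have hI : Measurable (A.indicator (1 : Θ → ℝ)) := measurable_one.indicator hA
  split_ifs with h
  · subst h
    have h1 := hZ.map_injective_eq hm (ι := Fin 1) (fun _ => i) (fun _ => 0)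
      (Function.injective_of_subsingleton _) (Function.injective_of_subsingleton _)
    have h2 := congrArg (fun ν : Measure (Fin 1 → Θ) => ∫ v, A.indicator (1 : Θ → ℝ) (v 0) ∂ν) h1
    beta_reduce at h2
    have h3 : Measurable fun v : Fin 1 → Θ => A.indicator (1 : Θ → ℝ) (v 0) :=
      hI.comp (measurable_pi_apply 0)
    rw [integral_map (by fun_prop) h3.aestronglyMeasurable,
      integral_map (by fun_prop) h3.aestronglyMeasurable] at h2
    rw [← h2]
    congr with ω
    by_cases h : Z i ω ∈ A <;> simp [h]
  · have h1 := hZ.map_injective_eq hm (ι := Fin 2) ![i, j] ![0, 1]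
      (by intro a b; fin_cases a <;> fin_cases b <;> simp [h, Ne.symm h])
      (by intro a b; fin_cases a <;> fin_cases b <;> simp)
    have h2 := congrArg (fun ν : Measure (Fin 2 → Θ) =>
      ∫ v, A.indicator (1 : Θ → ℝ) (v 0) * A.indicator (1 : Θ → ℝ) (v 1) ∂ν) h1
    beta_reduce at h2
    rw [integral_map (by fun_prop) (by fun_prop), integral_map (by fun_prop) (by fun_prop)] at h2
    simpa using h2

/-- The swap `(0 j)` preserves both the law of the sequence and the event, and carries coordinate
`j` to coordinate `0`. This is why invariance under these transpositions alone suffices. -/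
theorem Exchangeable.setIntegral_indicator (hZ : Exchangeable P Z) (hm : ∀ n, Measurable (Z n))
    {A : Set Θ} (hA : MeasurableSet A) {B : Set (ℕ → Θ)} (hB : MeasurableSet[swapInvariants Θ] B)
    (j : ℕ) :
    ∫ ω in (fun ω n => Z n ω) ⁻¹' B, A.indicator (1 : Θ → ℝ) (Z j ω) ∂P =
      ∫ ω in (fun ω n => Z n ω) ⁻¹' B, A.indicator (1 : Θ → ℝ) (Z 0 ω) ∂P := by
  have hI : Measurable (A.indicator (1 : Θ → ℝ)) := measurable_one.indicator hA
  have hB1 : MeasurableSet B := hB.1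
  have key : ∀ ζ : Ω → ℕ → Θ, Measurable ζ → ∫ ω in ζ ⁻¹' B, A.indicator (1 : Θ → ℝ) (ζ ω j) ∂P
      = ∫ z in B, A.indicator (1 : Θ → ℝ) (z j) ∂(P.map ζ) := fun ζ hζ => by
    have h1 : Measurable fun z : ℕ → Θ => A.indicator (1 : Θ → ℝ) (z j) :=
      hI.comp (measurable_pi_apply j)
    rw [setIntegral_map hB1 h1.aestronglyMeasurable hζ.aemeasurable]
  rw [key (fun ω n => Z n ω) (by fun_prop), ← hZ.map_comp_perm hm (Equiv.swap 0 j),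
    ← key _ (by fun_prop)]
  have h2 : (fun ω n => Z (Equiv.swap 0 j n) ω) ⁻¹' B = (fun ω n => Z n ω) ⁻¹' B := by
    conv_rhs => rw [← hB.2 j]
    rfl
  rw [h2]
  simp

/-- A regular conditional distribution with values in the space of probability measures. -/
theorem exists_condDistrib [StandardBorelSpace Θ] [Nonempty Θ] {T : Type*} {mT : MeasurableSpace T}
    {ζ : Ω → T} (hζ : Measurable ζ) {Y : Ω → Θ} (hY : Measurable Y) :
    ∃ q : T → ProbabilityMeasure Θ, Measurable q ∧ ∀ A : Set Θ, MeasurableSet A →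
      (fun ω => (q (ζ ω) : Measure Θ).real A) =ᵐ[P]
        P[(Y ⁻¹' A).indicator (fun _ => (1 : ℝ)) | mT.comap ζ] :=
  ⟨fun t => ⟨condDistrib Y ζ P t, inferInstance⟩,
    Measurable.subtype_mk (condDistrib Y ζ P).measurable,
    fun _ hA => condDistrib_ae_eq_condExp hζ hY hA⟩

/-- The directing random measure of an exchangeable sequence: a measurable function of the
sequence relative to which the centred indicators are orthogonal. -/
theorem Exchangeable.exists_directing [StandardBorelSpace Θ] [Nonempty Θ]
    (hZ : Exchangeable P Z) (hm : ∀ n, Measurable (Z n)) :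
    ∃ q : (ℕ → Θ) → ProbabilityMeasure Θ, Measurable q ∧
      ∀ A : Set Θ, MeasurableSet A → ∀ i j, i ≠ j →
        ∫ ω, (A.indicator 1 (Z i ω) - (q (fun n => Z n ω) : Measure Θ).real A) *
          (A.indicator 1 (Z j ω) - (q (fun n => Z n ω) : Measure Θ).real A) ∂P = 0 := by
  set ζ : Ω → ℕ → Θ := fun ω n => Z n ω with hζ
  have hζm : Measurable ζ := by fun_prop
  have hζG : Measurable[_, swapInvariants Θ] ζ := hζm.mono le_rfl swapInvariants_le
  obtain ⟨q, hqm, hq⟩ := exists_condDistrib (P := P) hζG (hm 0)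
  refine ⟨q, hqm.mono swapInvariants_le le_rfl, fun A hA i j hij => ?_⟩
  have hI : Measurable (A.indicator (1 : Θ → ℝ)) := measurable_one.indicator hA
  set X : ℕ → Ω → ℝ := fun i ω => A.indicator (1 : Θ → ℝ) (Z i ω) with hX
  have hXL : ∀ i, MemLp (X i) 2 P := fun i => memLp_indicator_comp hA (hm i) 2
  have hXae : ∀ i, (hXL i).toLp (X i) =ᵐ[P] X i := fun i => (hXL i).coeFn_toLp
  obtain ⟨L, hL, hort⟩ := exists_tendsto_average_of_inner_eq (x := fun i => (hXL i).toLp (X i))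
    (a := ∫ ω, A.indicator (1 : Θ → ℝ) (Z 0 ω) ∂P)
    (b := ∫ ω, A.indicator (1 : Θ → ℝ) (Z 0 ω) * A.indicator (1 : Θ → ℝ) (Z 1 ω) ∂P)
    (fun i j => by
      rw [← hZ.integral_indicator_mul hm hA i j, L2.inner_def]
      refine integral_congr_ae ?_
      filter_upwards [hXae i, hXae j] with ω h1 h2
      rw [h1, h2]
      simp [hX, mul_comm])
  have hXall : ∀ᵐ ω ∂P, ∀ i, (hXL i).toLp (X i) ω = X i ω := ae_all_iff.2 hXae
  -- the limit is almost surely a limit of frequencies along a subsequence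
  obtain ⟨ns, hns, hsub⟩ := (tendstoInMeasure_of_tendsto_Lp hL).exists_seq_tendsto_ae
  have havg : ∀ᵐ ω ∂P, ∀ n : ℕ, (((n : ℝ) + 1)⁻¹ • ∑ i ∈ Finset.range (n + 1),
      (hXL i).toLp (X i) : Lp ℝ 2 P) ω = frequency A (ζ ω) n := by
    refine ae_all_iff.2 fun n => ?_
    filter_upwards [hXall, Lp.coeFn_smul ((n : ℝ) + 1)⁻¹ (∑ i ∈ Finset.range (n + 1),
      (hXL i).toLp (X i)), Lp.coeFn_finsetSum (Finset.range (n + 1)) (fun i => (hXL i).toLp (X i))]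
      with ω h1 h2 h3
    rw [h2, Pi.smul_apply, h3]
    rw [Finset.sum_apply, Finset.sum_congr rfl fun i _ => h1 i]
    rfl
  -- `L` is only an almost everywhere class. The `limsup` gives a representative defined on every
  -- sequence and exactly swap-invariant, since a swap `(0 j)` changes no frequency at times `n ≥
  -- j`.
  set F : (ℕ → Θ) → ℝ := fun z => limsup (fun k => frequency A z (ns k)) atTop with hF
  have hFm : Measurable[swapInvariants Θ] F := by
    refine measurable_swapInvariants (Measurable.limsup fun k => measurable_frequency hA _) ?_
    intro j z
    refine limsup_congr ?_
    filter_upwards [hns.tendsto_atTop.eventually_ge_atTop j] with k hk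
    exact frequency_swap A z hk
  have hFL : (fun ω => F (ζ ω)) =ᵐ[P] L := by
    filter_upwards [hsub, havg] with ω h1 h2
    simp only [h2] at h1
    exact h1.limsup_eq
  have hcond : (fun ω => F (ζ ω)) =ᵐ[P]
      P[(Z 0 ⁻¹' A).indicator (fun _ => (1 : ℝ)) | (swapInvariants Θ).comap ζ] := by
    have hLint : Integrable L P := (Lp.memLp L).integrable (by norm_num)
    refine ae_eq_condExp_of_forall_setIntegral_eq hζG.comap_le
      ((integrable_const _).indicator (hm 0 hA))
      (fun s _ _ => (hLint.congr hFL.symm).integrableOn) ?_ ?_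
    · rintro s ⟨B, hB, rfl⟩ -
      have hBm : MeasurableSet (ζ ⁻¹' B) := hζG hB
      -- All indicators have the same integral over an invariant event, so the limit of their
      -- averages has it too.
      have h1 : inner ℝ (indicatorConstLp 2 hBm (measure_ne_top P _) (1 : ℝ)) L =
          ∫ ω in ζ ⁻¹' B, X 0 ω ∂P := by
        refine inner_limit_of_inner_eq_const hL fun j => ?_
        rw [L2.inner_indicatorConstLp_one, ← hZ.setIntegral_indicator hm hA hB j]
        exact integral_congr_ae (ae_restrict_of_ae (hXae j))
      rw [L2.inner_indicatorConstLp_one] at h1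
      rw [integral_congr_ae (ae_restrict_of_ae hFL), h1]
      rfl
    · exact (hFm.comp (comap_measurable ζ)).aestronglyMeasurable
  have hqF : (fun ω => (q (ζ ω) : Measure Θ).real A) =ᵐ[P] L :=
    ((hq A hA).trans hcond.symm).trans hFL
  have h0 := hort i j hij
  rw [L2.inner_def] at h0
  rw [← h0]
  refine integral_congr_ae ?_
  filter_upwards [hqF, hXall, Lp.coeFn_sub ((hXL i).toLp (X i)) L,
    Lp.coeFn_sub ((hXL j).toLp (X j)) L] with ω h1 h2 h3 h4
  rw [h3, h4]
  simp only [Pi.sub_apply, h2]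
  simp [← h1, hX, hζ, mul_comm]

end Directing

/-! ### The mixture representation -/

section MixtureRepresentation

variable {Ω Θ : Type*} [MeasurableSpace Ω] [MeasurableSpace Θ]
  {P : Measure Ω} [IsProbabilityMeasure P] {Z : ℕ → Ω → Θ}

omit [MeasurableSpace Θ] in
theorem indicator_one_mem_Icc (A : Set Θ) (θ : Θ) :
    A.indicator (1 : Θ → ℝ) θ ∈ Set.Icc (0 : ℝ) 1 := by
  by_cases h : θ ∈ A <;> simp [h]

theorem abs_prod_sub_prod_le {ι : Type*} (s : Finset ι) {a b : ι → ℝ}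
    (ha : ∀ i, a i ∈ Set.Icc (0 : ℝ) 1) (hb : ∀ i, b i ∈ Set.Icc (0 : ℝ) 1) :
    |∏ i ∈ s, a i - ∏ i ∈ s, b i| ≤ ∑ i ∈ s, |a i - b i| := by
  classical
  induction s using Finset.induction with
  | empty => simp
  | insert j s hj ih =>
    rw [Finset.prod_insert hj, Finset.prod_insert hj, Finset.sum_insert hj]
    have h1 : |∏ i ∈ s, b i| ≤ 1 := by
      rw [abs_of_nonneg (Finset.prod_nonneg fun i _ => (hb i).1)]
      exact Finset.prod_le_one (fun i _ => (hb i).1) fun i _ => (hb i).2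
    have h2 : |a j| ≤ 1 := by rw [abs_of_nonneg (ha j).1]; exact (ha j).2
    calc |a j * ∏ i ∈ s, a i - b j * ∏ i ∈ s, b i|
        = |a j * (∏ i ∈ s, a i - ∏ i ∈ s, b i) + (a j - b j) * ∏ i ∈ s, b i| := by ring_nf
      _ ≤ |a j| * |∏ i ∈ s, a i - ∏ i ∈ s, b i| + |a j - b j| * |∏ i ∈ s, b i| := by
        rw [← abs_mul, ← abs_mul]; exact abs_add_le _ _
      _ ≤ 1 * |∏ i ∈ s, a i - ∏ i ∈ s, b i| + |a j - b j| * 1 := by gcongr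
      _ ≤ |a j - b j| + ∑ i ∈ s, |a i - b i| := by linarith

theorem integral_sq_sum_le_card {ι : Type*} {Y : ι → Ω → ℝ} (hY : ∀ i, Measurable (Y i))
    (hb : ∀ i ω, |Y i ω| ≤ 1) (horth : ∀ i j, i ≠ j → ∫ ω, Y i ω * Y j ω ∂P = 0)
    (s : Finset ι) : ∫ ω, (∑ i ∈ s, Y i ω) ^ 2 ∂P ≤ s.card := by
  classical
  have hint : ∀ i j, Integrable (fun ω => Y i ω * Y j ω) P := fun i j =>
    Integrable.of_bound ((hY i).mul (hY j)).aestronglyMeasurable 1 (.of_forall fun ω => by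
      rw [Real.norm_eq_abs, abs_mul]
      exact mul_le_one₀ (hb i ω) (abs_nonneg _) (hb j ω))
  have h1 : ∀ ω, (∑ i ∈ s, Y i ω) ^ 2 = ∑ i ∈ s, ∑ j ∈ s, Y i ω * Y j ω := fun ω => by
    rw [sq, Finset.sum_mul_sum]
  simp_rw [h1]
  rw [integral_finsetSum _ fun i _ => integrable_finsetSum _ fun j _ => hint i j]
  calc ∑ i ∈ s, ∫ ω, ∑ j ∈ s, Y i ω * Y j ω ∂P ≤ ∑ i ∈ s, (1 : ℝ) := by
        refine Finset.sum_le_sum fun i hi => ?_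
        rw [integral_finsetSum _ fun j _ => hint i j,
          Finset.sum_eq_single_of_mem i hi fun j _ hj => horth i j hj.symm]
        calc ∫ ω, Y i ω * Y i ω ∂P ≤ ∫ _, (1 : ℝ) ∂P :=
              integral_mono (hint i i) (integrable_const 1) fun ω => by
                have := abs_le.1 (hb i ω)
                nlinarith
          _ = 1 := by simp
    _ = s.card := by simp

omit [IsProbabilityMeasure P] in
theorem Exchangeable.integral_prod_indicator (hZ : Exchangeable P Z) (hm : ∀ n, Measurable (Z n))
    {r : ℕ} {A : Fin r → Set Θ} (hA : ∀ i, MeasurableSet (A i)) (e : Fin r → ℕ)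
    (he : Function.Injective e) :
    ∫ ω, ∏ i, (A i).indicator (1 : Θ → ℝ) (Z (e i) ω) ∂P =
      ∫ ω, ∏ i : Fin r, (A i).indicator (1 : Θ → ℝ) (Z i ω) ∂P := by
  have hI : Measurable fun v : Fin r → Θ => ∏ i, (A i).indicator (1 : Θ → ℝ) (v i) :=
    Finset.measurable_prod _ fun i _ => (measurable_one.indicator (hA i)).comp
      (measurable_pi_apply i)
  have h := congrArg (fun ν : Measure (Fin r → Θ) =>
    ∫ v, ∏ i, (A i).indicator (1 : Θ → ℝ) (v i) ∂ν) (hZ.map_injective_eq_fin hm e he)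
  beta_reduce at h
  rwa [integral_map (by fun_prop) hI.aestronglyMeasurable,
    integral_map (by fun_prop) hI.aestronglyMeasurable] at h

/-- Each indicator is replaced by an average over one residue class modulo `r`. The classes are
disjoint, so exchangeability leaves the expected product unchanged. Each average is within `(n +
1)^(-1/2)` of `Q(A_i)` in L¹, and `n → ∞` gives the identity. -/
theorem Exchangeable.integral_prod_indicator_eq (hZ : Exchangeable P Z)
    (hm : ∀ n, Measurable (Z n)) {Q : Ω → ProbabilityMeasure Θ} (hQ : Measurable Q)
    (horth : ∀ A : Set Θ, MeasurableSet A → ∀ i j, i ≠ j →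
      ∫ ω, (A.indicator 1 (Z i ω) - (Q ω : Measure Θ).real A) *
        (A.indicator 1 (Z j ω) - (Q ω : Measure Θ).real A) ∂P = 0)
    {r : ℕ} {A : Fin r → Set Θ} (hA : ∀ i, MeasurableSet (A i)) :
    ∫ ω, ∏ i : Fin r, (A i).indicator (1 : Θ → ℝ) (Z i ω) ∂P =
      ∫ ω, ∏ i, (Q ω : Measure Θ).real (A i) ∂P := by
  have hQm : ∀ i, Measurable fun ω => (Q ω : Measure Θ).real (A i) := fun i =>
    ((Measure.measurable_coe (hA i)).comp (measurable_subtype_coe.comp hQ)).ennreal_toReal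
  have hZm : ∀ i n, Measurable fun ω => (A i).indicator (1 : Θ → ℝ) (Z n ω) := fun i n =>
    (measurable_one.indicator (hA i)).comp (hm n)
  have hQ01 : ∀ ω i, (Q ω : Measure Θ).real (A i) ∈ Set.Icc (0 : ℝ) 1 := fun ω i =>
    ⟨measureReal_nonneg, measureReal_le_one⟩
  set B : ℕ → Fin r → Ω → ℝ := fun n i ω =>
    ((n : ℝ) + 1)⁻¹ * ∑ t ∈ Finset.range (n + 1), (A i).indicator (1 : Θ → ℝ) (Z (r * t + i) ω)
    with hB
  have hBm : ∀ n i, Measurable (B n i) := fun n i =>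
    (Finset.measurable_sum _ fun t _ => hZm i _).const_mul _
  have hB01 : ∀ n ω i, B n i ω ∈ Set.Icc (0 : ℝ) 1 := by
    intro n ω i
    have h0 : 0 ≤ ∑ t ∈ Finset.range (n + 1), (A i).indicator (1 : Θ → ℝ) (Z (r * t + i) ω) :=
      Finset.sum_nonneg fun t _ => (indicator_one_mem_Icc _ _).1
    have h1 : ∑ t ∈ Finset.range (n + 1), (A i).indicator (1 : Θ → ℝ) (Z (r * t + i) ω) ≤
        ∑ t ∈ Finset.range (n + 1), (1 : ℝ) :=
      Finset.sum_le_sum fun t _ => (indicator_one_mem_Icc _ _).2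
    simp only [Finset.sum_const, Finset.card_range, nsmul_eq_mul, mul_one] at h1
    push_cast at h1
    refine ⟨by positivity, ?_⟩
    rw [hB, inv_mul_le_iff₀ (by positivity)]
    linarith
  -- products of averages over disjoint blocks have the right expectation
  have hprod : ∀ n, ∫ ω, ∏ i, B n i ω ∂P =
      ∫ ω, ∏ i : Fin r, (A i).indicator (1 : Θ → ℝ) (Z i ω) ∂P := by
    intro n
    have h1 : ∀ ω, ∏ i, B n i ω = (((n : ℝ) + 1)⁻¹) ^ r *
        ∑ p ∈ Fintype.piFinset fun _ : Fin r => Finset.range (n + 1),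
          ∏ i, (A i).indicator (1 : Θ → ℝ) (Z (r * p i + i) ω) := by
      intro ω
      simp only [hB]
      rw [Finset.prod_mul_distrib, Finset.prod_univ_sum]
      simp
    simp_rw [h1]
    rw [integral_const_mul, integral_finsetSum]
    · have hinj : ∀ p : Fin r → ℕ, Function.Injective fun i : Fin r => r * p i + i := by
        intro p i j hij
        have h2 := congrArg (· % r) hij
        simp only [Nat.mul_add_mod, Nat.mod_eq_of_lt i.2, Nat.mod_eq_of_lt j.2] at h2
        exact Fin.ext h2
      rw [Finset.sum_congr rfl fun p _ => hZ.integral_prod_indicator hm hA _ (hinj p)]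
      simp only [Finset.sum_const, Fintype.card_piFinset, Finset.card_range, Finset.prod_const,
        Finset.card_univ, Fintype.card_fin, nsmul_eq_mul]
      push_cast
      rw [← mul_assoc, ← mul_pow, inv_mul_cancel₀ (by positivity), one_pow, one_mul]
    · intro p _
      refine Integrable.of_bound (Finset.measurable_prod _ fun i _ => hZm i _).aestronglyMeasurable
        1 (.of_forall fun ω => ?_)
      rw [Real.norm_of_nonneg (Finset.prod_nonneg fun i _ => (indicator_one_mem_Icc _ _).1)]
      exact Finset.prod_le_one (fun i _ => (indicator_one_mem_Icc _ _).1)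
        fun i _ => (indicator_one_mem_Icc _ _).2
  have hdiff : ∀ n i, ∫ ω, |B n i ω - (Q ω : Measure Θ).real (A i)| ∂P ≤ (√((n : ℝ) + 1))⁻¹ := by
    intro n i
    set c := √((n : ℝ) + 1) with hc
    have hc0 : 0 < c := by positivity
    have hc2 : c ^ 2 = (n : ℝ) + 1 := Real.sq_sqrt (by positivity)
    set S : Ω → ℝ := fun ω => ∑ t ∈ Finset.range (n + 1),
      ((A i).indicator (1 : Θ → ℝ) (Z (r * t + i) ω) - (Q ω : Measure Θ).real (A i)) with hS
    have hSm : Measurable S := Finset.measurable_sum _ fun t _ => (hZm i _).sub (hQm i)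
    have hBS : ∀ ω, B n i ω - (Q ω : Measure Θ).real (A i) = (c ^ 2)⁻¹ * S ω := by
      intro ω
      simp only [hB, hS, Finset.sum_sub_distrib, Finset.sum_const, Finset.card_range, nsmul_eq_mul,
        hc2]
      push_cast
      field_simp
    have hr : 0 < r := Nat.pos_of_ne_zero fun h => by subst h; exact i.elim0
    have hb1 : ∀ t ω, |(A i).indicator (1 : Θ → ℝ) (Z (r * t + i) ω)
        - (Q ω : Measure Θ).real (A i)| ≤ 1 := fun t ω => by
      have h1 := indicator_one_mem_Icc (A i) (Z (r * t + i) ω)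
      have h2 := hQ01 ω i
      rw [abs_le]; constructor <;> linarith [h1.1, h1.2, h2.1, h2.2]
    have hSsq : ∫ ω, S ω ^ 2 ∂P ≤ c ^ 2 := by
      have h := integral_sq_sum_le_card (P := P) (Y := fun (t : ℕ) ω =>
        (A i).indicator (1 : Θ → ℝ) (Z (r * t + i) ω) - (Q ω : Measure Θ).real (A i))
        (fun t => (hZm i _).sub (hQm i)) hb1 (fun t u htu => horth _ (hA i) _ _ (by
          intro h
          exact htu (Nat.eq_of_mul_eq_mul_left hr (by omega)))) (Finset.range (n + 1))
      rw [hc2]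
      rw [Finset.card_range] at h
      exact_mod_cast h
    have hSb : ∀ ω, |S ω| ≤ n + 1 := fun ω => by
      refine (Finset.abs_sum_le_sum_abs _ _).trans ((Finset.sum_le_sum fun t _ => hb1 t ω).trans ?_)
      simp
    have hSint : Integrable (fun ω => S ω ^ 2) P :=
      Integrable.of_bound (hSm.pow_const 2).aestronglyMeasurable (((n : ℝ) + 1) ^ 2)
        (.of_forall fun ω => by
          rw [norm_pow, Real.norm_eq_abs]; gcongr; exact hSb ω)
    have hSabs : Integrable (fun ω => |S ω|) P :=
      Integrable.of_bound hSm.abs.aestronglyMeasurable ((n : ℝ) + 1) (.of_forall fun ω => by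
          simpa using hSb ω)
    have hS1 : ∫ ω, |S ω| ∂P ≤ c := by
      -- The AM-GM inequality, in place of Cauchy–Schwarz, passes from the second moment to the
      -- first; `c` is the optimal scale.
      have h1 : ∀ ω, |S ω| ≤ (2 * c)⁻¹ * S ω ^ 2 + c / 2 := fun ω => by
        rw [← sq_abs (S ω)]
        have : (2 * c)⁻¹ * |S ω| ^ 2 + c / 2 - |S ω| = (2 * c)⁻¹ * (|S ω| - c) ^ 2 := by
          field_simp; ring
        have h3 : 0 ≤ (2 * c)⁻¹ * (|S ω| - c) ^ 2 := by positivity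
        linarith
      calc ∫ ω, |S ω| ∂P ≤ ∫ ω, ((2 * c)⁻¹ * S ω ^ 2 + c / 2) ∂P :=
            integral_mono hSabs ((hSint.const_mul _).add (integrable_const _)) h1
        _ = (2 * c)⁻¹ * ∫ ω, S ω ^ 2 ∂P + c / 2 := by
            rw [integral_add (hSint.const_mul _) (integrable_const _), integral_const_mul]; simp
        _ ≤ (2 * c)⁻¹ * c ^ 2 + c / 2 := by gcongr
        _ = c := by field_simp; ring
    simp_rw [hBS, abs_mul]
    rw [integral_const_mul, abs_of_nonneg (by positivity)]
    calc (c ^ 2)⁻¹ * ∫ ω, |S ω| ∂P ≤ (c ^ 2)⁻¹ * c := by gcongr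
      _ = c⁻¹ := by field_simp
  have hBint : ∀ n, Integrable (fun ω => ∏ i, B n i ω) P := fun n =>
    Integrable.of_bound (Finset.measurable_prod _ fun i _ => hBm n i).aestronglyMeasurable 1
      (.of_forall fun ω => by
        rw [Real.norm_of_nonneg (Finset.prod_nonneg fun i _ => (hB01 n ω i).1)]
        exact Finset.prod_le_one (fun i _ => (hB01 n ω i).1) fun i _ => (hB01 n ω i).2)
  have hQint : Integrable (fun ω => ∏ i, (Q ω : Measure Θ).real (A i)) P :=
    Integrable.of_bound (Finset.measurable_prod _ fun i _ => hQm i).aestronglyMeasurable 1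
      (.of_forall fun ω => by
        rw [Real.norm_of_nonneg (Finset.prod_nonneg fun i _ => (hQ01 ω i).1)]
        exact Finset.prod_le_one (fun i _ => (hQ01 ω i).1) fun i _ => (hQ01 ω i).2)
  have habs : ∀ n i, Integrable (fun ω => |B n i ω - (Q ω : Measure Θ).real (A i)|) P := fun n i =>
    Integrable.of_bound ((hBm n i).sub (hQm i)).abs.aestronglyMeasurable 1
      (.of_forall fun ω => by
        have h1 := hB01 n ω i
        have h2 := hQ01 ω i
        rw [Real.norm_eq_abs, abs_abs, abs_le]
        constructor <;> linarith [h1.1, h1.2, h2.1, h2.2])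
  have hbound : ∀ n : ℕ, |∫ ω, ∏ i : Fin r, (A i).indicator (1 : Θ → ℝ) (Z i ω) ∂P -
      ∫ ω, ∏ i, (Q ω : Measure Θ).real (A i) ∂P| ≤ r * (√((n : ℝ) + 1))⁻¹ := by
    intro n
    rw [← hprod n, ← integral_sub (hBint n) hQint]
    calc |∫ ω, (∏ i, B n i ω - ∏ i, (Q ω : Measure Θ).real (A i)) ∂P|
        ≤ ∫ ω, |∏ i, B n i ω - ∏ i, (Q ω : Measure Θ).real (A i)| ∂P := abs_integral_le_integral_abs
      _ ≤ ∫ ω, ∑ i, |B n i ω - (Q ω : Measure Θ).real (A i)| ∂P :=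
          integral_mono ((hBint n).sub hQint).abs (integrable_finsetSum _ fun i _ => habs n i)
            fun ω => abs_prod_sub_prod_le _ (hB01 n ω) (hQ01 ω)
      _ = ∑ i, ∫ ω, |B n i ω - (Q ω : Measure Θ).real (A i)| ∂P :=
          integral_finsetSum _ fun i _ => habs n i
      _ ≤ ∑ _i : Fin r, (√((n : ℝ) + 1))⁻¹ := Finset.sum_le_sum fun i _ => hdiff n i
      _ = r * (√((n : ℝ) + 1))⁻¹ := by simp
  have hlim : Tendsto (fun n : ℕ => r * (√((n : ℝ) + 1))⁻¹) atTop (𝓝 (r * 0)) := by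
    refine tendsto_const_nhds.mul (tendsto_inv_atTop_zero.comp (Real.tendsto_sqrt_atTop.comp ?_))
    exact tendsto_natCast_atTop_atTop.atTop_add tendsto_const_nhds
  rw [mul_zero] at hlim
  exact sub_eq_zero.1 (abs_nonpos_iff.1 (ge_of_tendsto' hlim hbound))

theorem Exchangeable.isDeFinettiMeasure_map (hZ : Exchangeable P Z)
    (hm : ∀ n, Measurable (Z n)) {Q : Ω → ProbabilityMeasure Θ} (hQ : Measurable Q)
    (horth : ∀ A : Set Θ, MeasurableSet A → ∀ i j, i ≠ j →
      ∫ ω, (A.indicator 1 (Z i ω) - (Q ω : Measure Θ).real A) *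
        (A.indicator 1 (Z j ω) - (Q ω : Measure Θ).real A) ∂P = 0) :
    IsDeFinettiMeasure P Z (P.map Q) := by
  refine ⟨Measure.isProbabilityMeasure_map hQ.aemeasurable, fun r A hA => ?_⟩
  have hcoe : ∀ i, Measurable fun p : ProbabilityMeasure Θ => (p : Measure Θ) (A i) := fun i =>
    (Measure.measurable_coe (hA i)).comp measurable_subtype_coe
  rw [lintegral_map (Finset.measurable_prod _ fun i _ => hcoe i) hQ]
  have hset : MeasurableSet {ω | ∀ i : Fin r, Z i ω ∈ A i} := by
    rw [Set.ofPred_forall]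
    exact .iInter fun i => hm i (hA i)
  have h := hZ.integral_prod_indicator_eq hm hQ horth hA
  have h1 : ∫ ω, ∏ i : Fin r, (A i).indicator (1 : Θ → ℝ) (Z i ω) ∂P =
      P.real {ω | ∀ i : Fin r, Z i ω ∈ A i} := by
    rw [← integral_indicator_one hset]
    congr with ω
    by_cases hω : ∀ i : Fin r, Z i ω ∈ A i
    · simp [hω]
    · rw [Set.indicator_of_notMem (by simpa using hω)]
      push Not at hω
      obtain ⟨i, hi⟩ := hω
      exact Finset.prod_eq_zero (Finset.mem_univ i) (by simp [hi])
  have h2 : ∫ ω, ∏ i, (Q ω : Measure Θ).real (A i) ∂P =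
      (∫⁻ ω, ∏ i, (Q ω : Measure Θ) (A i) ∂P).toReal := by
    rw [← integral_toReal]
    · simp [measureReal_def, ENNReal.toReal_prod]
    · exact (Finset.measurable_prod _ fun i _ => (hcoe i).comp hQ).aemeasurable
    · exact .of_forall fun ω => ENNReal.prod_lt_top fun i _ => measure_lt_top _ _
  rw [h1, h2, measureReal_def] at h
  refine (ENNReal.toReal_eq_toReal_iff' (measure_ne_top _ _) ?_).1 h
  refine ne_top_of_le_ne_top (b := 1) ENNReal.one_ne_top ?_
  calc ∫⁻ ω, ∏ i, (Q ω : Measure Θ) (A i) ∂P ≤ ∫⁻ _, 1 ∂P :=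
        lintegral_mono fun ω => Finset.prod_le_one' fun i _ => prob_le_one
    _ = 1 := by simp

end MixtureRepresentation

/-! ### Moments of the beta distribution -/

section BetaMoments

theorem ae_betaMeasure_mem_Ioo (α β : ℝ) : ∀ᵐ x ∂betaMeasure α β, x ∈ Set.Ioo (0 : ℝ) 1 := by
  have hm : Measurable (betaPDF α β) := (measurable_betaPDFReal α β).ennreal_ofReal
  rw [betaMeasure, ae_withDensity_iff hm]
  refine .of_forall fun x hx => ?_
  by_contra h
  refine hx ?_
  rw [betaPDF_eq, if_neg (show ¬(0 < x ∧ x < 1) from h), ENNReal.ofReal_zero]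

theorem betaPDFReal_nonneg {α β : ℝ} (hα : 0 < α) (hβ : 0 < β) (x : ℝ) :
    0 ≤ betaPDFReal α β x := by
  by_cases h : 0 < x ∧ x < 1
  · exact (betaPDFReal_pos h.1 h.2 hα hβ).le
  · rw [betaPDFReal, if_neg h]

theorem integral_betaPDFReal {α β : ℝ} (hα : 0 < α) (hβ : 0 < β) :
    ∫ x, betaPDFReal α β x = 1 := by
  rw [integral_eq_lintegral_of_nonneg_ae (.of_forall (betaPDFReal_nonneg hα hβ))
    (measurable_betaPDFReal α β).aestronglyMeasurable]
  exact (congrArg ENNReal.toReal (lintegral_betaPDF_eq_one hα hβ)).trans ENNReal.toReal_one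

theorem integral_betaMeasure {α β : ℝ} (hα : 0 < α) (hβ : 0 < β) (g : ℝ → ℝ) :
    ∫ x, g x ∂betaMeasure α β = ∫ x, betaPDFReal α β x * g x := by
  have hm : Measurable (betaPDF α β) := (measurable_betaPDFReal α β).ennreal_ofReal
  rw [betaMeasure, integral_withDensity_eq_integral_toReal_smul hm
    (.of_forall fun x => ENNReal.ofReal_lt_top)]
  simp only [betaPDF, ENNReal.toReal_ofReal (betaPDFReal_nonneg hα hβ _), smul_eq_mul]

/-- Multiplying the `Beta(1, s)` density by `x²` gives a multiple of the `Beta(3, s)` density, so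
the moment is a ratio of beta functions. For `(1 - x)²` the second parameter shifts to `s + 2`
instead. -/
theorem integral_sq_betaMeasure_one {s : ℝ} (hs : 0 < s) :
    ∫ x, x ^ 2 ∂betaMeasure 1 s = 2 / ((s + 1) * (s + 2)) := by
  have h1 : ∀ x, betaPDFReal 1 s x * x ^ 2 = beta 3 s / beta 1 s * betaPDFReal 3 s x := by
    intro x
    unfold betaPDFReal
    split_ifs with h
    · have h2 : x ^ ((3 : ℝ) - 1) = x ^ 2 := by
        rw [← Real.rpow_natCast]; norm_num
      have h3 := (beta_pos (α := 3) (β := s) (by norm_num) hs).ne'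
      have h4 := (beta_pos (α := 1) (β := s) (by norm_num) hs).ne'
      rw [h2, sub_self, Real.rpow_zero]
      field_simp
    · simp
  rw [integral_betaMeasure one_pos hs]
  simp_rw [h1]
  rw [integral_const_mul, integral_betaPDFReal (by norm_num) hs, mul_one]
  have h5 : Real.Gamma (3 + s) = (s + 2) * ((s + 1) * Real.Gamma (1 + s)) := by
    rw [show (3 : ℝ) + s = (s + 2) + 1 by ring, Real.Gamma_add_one (by positivity),
      show s + 2 = (s + 1) + 1 by ring, Real.Gamma_add_one (by positivity), add_comm s 1]
  have h6 : Real.Gamma 3 = 2 := by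
    rw [show (3 : ℝ) = (2 : ℕ) + 1 by norm_num, Real.Gamma_nat_eq_factorial]
    simp
  have h7 := (Real.Gamma_pos_of_pos hs).ne'
  have h8 := (Real.Gamma_pos_of_pos (add_pos one_pos hs)).ne'
  unfold beta
  rw [h5, h6, Real.Gamma_one]
  field_simp

theorem integral_one_sub_sq_betaMeasure_one {s : ℝ} (hs : 0 < s) :
    ∫ x, (1 - x) ^ 2 ∂betaMeasure 1 s = s / (s + 2) := by
  have h1 : ∀ x, betaPDFReal 1 s x * (1 - x) ^ 2 =
      beta 1 (s + 2) / beta 1 s * betaPDFReal 1 (s + 2) x := by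
    intro x
    unfold betaPDFReal
    split_ifs with h
    · have h2 : (1 - x) ^ (s + 2 - 1) = (1 - x) ^ (s - 1) * (1 - x) ^ 2 := by
        rw [show s + 2 - 1 = (s - 1) + (2 : ℕ) by push_cast; ring,
          Real.rpow_add (by linarith [h.2]), Real.rpow_natCast]
      have h3 := (beta_pos (α := 1) (β := s + 2) (by norm_num) (by positivity)).ne'
      have h4 := (beta_pos (α := 1) (β := s) (by norm_num) hs).ne'
      rw [h2]
      field_simp
    · simp
  rw [integral_betaMeasure one_pos hs]
  simp_rw [h1]
  rw [integral_const_mul, integral_betaPDFReal (by norm_num) (by positivity), mul_one]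
  have h5 : Real.Gamma (1 + (s + 2)) = (s + 2) * Real.Gamma (s + 2) := by
    rw [add_comm 1, Real.Gamma_add_one (by positivity)]
  have h6 : Real.Gamma (1 + s) = s * Real.Gamma s := by
    rw [add_comm 1, Real.Gamma_add_one hs.ne']
  have h7 := (Real.Gamma_pos_of_pos hs).ne'
  have h8 := (Real.Gamma_pos_of_pos (show 0 < s + 2 by positivity)).ne'
  unfold beta
  rw [h5, h6, Real.Gamma_one]
  field_simp

end BetaMoments

/-! ### Mean square and almost sure convergence of the chain -/

section Recursion

variable {Ω : Type*} [MeasurableSpace Ω] {P : Measure Ω} [IsProbabilityMeasure P]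

theorem indepFun_prodMk_of_indepFun_prodMk {α β γ : Type*} [MeasurableSpace α] [MeasurableSpace β]
    [MeasurableSpace γ] {X : Ω → α} {Y : Ω → β} {T : Ω → γ} (hX : Measurable X)
    (hY : Measurable Y) (hT : Measurable T) (hXY : IndepFun X Y P)
    (hXYT : IndepFun (fun ω => (X ω, Y ω)) T P) : IndepFun X (fun ω => (Y ω, T ω)) P := by
  have := Measure.isProbabilityMeasure_map (μ := P) hX.aemeasurable
  have := Measure.isProbabilityMeasure_map (μ := P) hY.aemeasurable
  have := Measure.isProbabilityMeasure_map (μ := P) hT.aemeasurable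
  have hYT : IndepFun Y T P := hXYT.comp measurable_snd measurable_id
  rw [indepFun_iff_map_prod_eq_prod_map_map (by fun_prop) (by fun_prop)] at hXY hXYT hYT ⊢
  rw [hYT, ← Measure.prodAssoc_prod, ← hXY, ← hXYT,
    Measure.map_map (by fun_prop) (by fun_prop)]
  rfl

/-- The recursion `D (n + 1) = (1 - V n) D n + V n Y n` driven by weights with the first two
moments of `Beta(1, n)` and orthogonal innovations. -/
theorem integral_sq_le_of_recursion {V Y D : ℕ → Ω → ℝ} (hV : ∀ n, Measurable (V n))
    (hY : ∀ n, Measurable (Y n)) (hD : ∀ n, Measurable (D n))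
    (hV01 : ∀ᵐ ω ∂P, ∀ n, V n ω ∈ Set.Icc (0 : ℝ) 1) (hV0 : ∀ᵐ ω ∂P, V 0 ω = 1)
    (hYb : ∀ n ω, |Y n ω| ≤ 1) (hDb : ∀ᵐ ω ∂P, ∀ n, |D n ω| ≤ 1)
    (hrec : ∀ n ω, D (n + 1) ω = (1 - V n ω) * D n ω + V n ω * Y n ω)
    (hind : ∀ n, IndepFun (V n) (fun ω => (D n ω, fun m => Y m ω)) P)
    (horth : ∀ i j, i ≠ j → ∫ ω, Y i ω * Y j ω ∂P = 0)
    (hm1 : ∀ n, 1 ≤ n → ∫ ω, V n ω ^ 2 ∂P = 2 / (((n : ℝ) + 1) * (n + 2)))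
    (hm2 : ∀ n, 1 ≤ n → ∫ ω, (1 - V n ω) ^ 2 ∂P = (n : ℝ) / (n + 2)) (n : ℕ) :
    ∫ ω, D (n + 1) ω ^ 2 ∂P ≤ 2 / ((n : ℝ) + 2) := by
  have hint : ∀ f : Ω → ℝ, Measurable f → (∀ᵐ ω ∂P, |f ω| ≤ 1) → Integrable f P := fun f hf hb =>
    Integrable.of_bound hf.aestronglyMeasurable 1 hb
  have hab : ∀ {a b : ℝ}, |a| ≤ 1 → |b| ≤ 1 → |a * b| ≤ 1 := fun ha hb => by
    rw [abs_mul]; exact mul_le_one₀ ha (abs_nonneg _) hb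
  have hbd : ∀ᵐ ω ∂P, ∀ n, |V n ω| ≤ 1 ∧ |1 - V n ω| ≤ 1 ∧ |D n ω| ≤ 1 ∧ |Y n ω| ≤ 1 := by
    filter_upwards [hV01, hDb] with ω h1 h2 n
    refine ⟨abs_le.2 ?_, abs_le.2 ?_, h2 n, hYb n ω⟩ <;>
      constructor <;> linarith [(h1 n).1, (h1 n).2]
  have hD1 : ∀ᵐ ω ∂P, D 1 ω = Y 0 ω := by
    filter_upwards [hV0] with ω h
    rw [hrec 0, h]; ring
  have hfac : ∀ (n : ℕ) (g : ℝ → ℝ) (F : ℝ × (ℕ → ℝ) → ℝ), Measurable g → Measurable F →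
      ∫ ω, g (V n ω) * F (D n ω, fun m => Y m ω) ∂P =
        (∫ ω, g (V n ω) ∂P) * ∫ ω, F (D n ω, fun m => Y m ω) ∂P := by
    intro n g F hg hF
    exact ((hind n).comp hg hF).integral_fun_mul_eq_mul_integral
      (hg.comp (hV n)).aestronglyMeasurable
      (hF.comp ((hD n).prodMk (measurable_pi_lambda _ hY))).aestronglyMeasurable
  -- Past errors are orthogonal to later innovations. The index starts at `n + 1` because `D 0` need
  -- not be orthogonal to anything; the first weight `1` erases it and leaves `D 1 = Y 0`.
  have hcross : ∀ n m, n + 1 ≤ m → ∫ ω, D (n + 1) ω * Y m ω ∂P = 0 := by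
    intro n
    induction n with
    | zero =>
      intro m hm
      rw [← horth 0 m (by omega)]
      refine integral_congr_ae ?_
      filter_upwards [hD1] with ω h
      rw [h]
    | succ n ih =>
      intro m hm
      have h1 : ∀ ω, D (n + 1 + 1) ω * Y m ω =
          (1 - V (n + 1) ω) * (D (n + 1) ω * Y m ω) + V (n + 1) ω * (Y (n + 1) ω * Y m ω) :=
        fun ω => by rw [hrec]; ring
      have h2 := hfac (n + 1) (fun v => 1 - v) (fun p => p.1 * p.2 m) (by fun_prop) (by fun_prop)
      have h3 := hfac (n + 1) (fun v => v) (fun p => p.2 (n + 1) * p.2 m) (by fun_prop)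
        (by fun_prop)
      simp only at h2 h3
      simp_rw [h1]
      rw [integral_add, h2, h3, ih m (by omega), horth _ _ (by omega)]
      · simp
      · refine hint _ (by fun_prop) ?_
        filter_upwards [hbd] with ω h
        exact hab (h _).2.1 (hab (h _).2.2.1 (h _).2.2.2)
      · refine hint _ (by fun_prop) ?_
        filter_upwards [hbd] with ω h
        exact hab (h _).1 (hab (h _).2.2.2 (h _).2.2.2)
  have hY1 : ∀ n, ∫ ω, Y n ω ^ 2 ∂P ≤ 1 := fun n => by
    have h1 : ∫ ω, Y n ω ^ 2 ∂P ≤ ∫ _, (1 : ℝ) ∂P :=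
      integral_mono (hint _ (by fun_prop) (.of_forall fun ω => by
        rw [sq]; exact hab (hYb n ω) (hYb n ω))) (integrable_const _) fun ω => by
          have := abs_le.1 (hYb n ω)
          nlinarith
    simpa using h1
  induction n with
  | zero =>
    have h1 : ∫ ω, D (0 + 1) ω ^ 2 ∂P = ∫ ω, Y 0 ω ^ 2 ∂P := integral_congr_ae (by
      filter_upwards [hD1] with ω h
      rw [zero_add, h])
    rw [h1]
    norm_num
    exact hY1 0
  | succ n ih =>
    have h1 : ∀ ω, D (n + 1 + 1) ω ^ 2 = (1 - V (n + 1) ω) ^ 2 * D (n + 1) ω ^ 2 +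
        (2 * (V (n + 1) ω * (1 - V (n + 1) ω)) * (D (n + 1) ω * Y (n + 1) ω) +
          V (n + 1) ω ^ 2 * Y (n + 1) ω ^ 2) := fun ω => by rw [hrec]; ring
    have h2 := hfac (n + 1) (fun v => (1 - v) ^ 2) (fun p => p.1 ^ 2) (by fun_prop) (by fun_prop)
    have h3 := hfac (n + 1) (fun v => 2 * (v * (1 - v))) (fun p => p.1 * p.2 (n + 1))
      (by fun_prop) (by fun_prop)
    have h4 := hfac (n + 1) (fun v => v ^ 2) (fun p => p.2 (n + 1) ^ 2) (by fun_prop)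
      (by fun_prop)
    simp only at h2 h3 h4
    have i1 : Integrable (fun ω => (1 - V (n + 1) ω) ^ 2 * D (n + 1) ω ^ 2) P := by
      refine hint _ (by fun_prop) ?_
      filter_upwards [hbd] with ω h
      rw [sq, sq]
      exact hab (hab (h _).2.1 (h _).2.1) (hab (h _).2.2.1 (h _).2.2.1)
    have i2 : Integrable (fun ω => 2 * (V (n + 1) ω * (1 - V (n + 1) ω)) *
        (D (n + 1) ω * Y (n + 1) ω)) P := by
      simp_rw [mul_assoc]
      refine (hint _ (by fun_prop) ?_).const_mul 2
      filter_upwards [hbd] with ω h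
      exact hab (h _).1 (hab (h _).2.1 (hab (h _).2.2.1 (h _).2.2.2))
    have i3 : Integrable (fun ω => V (n + 1) ω ^ 2 * Y (n + 1) ω ^ 2) P := by
      refine hint _ (by fun_prop) ?_
      filter_upwards [hbd] with ω h
      rw [sq, sq]
      exact hab (hab (h _).1 (h _).1) (hab (h _).2.2.2 (h _).2.2.2)
    have i23 : Integrable (fun ω => 2 * (V (n + 1) ω * (1 - V (n + 1) ω)) *
        (D (n + 1) ω * Y (n + 1) ω) + V (n + 1) ω ^ 2 * Y (n + 1) ω ^ 2) P := i2.add i3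
    simp_rw [h1]
    rw [integral_add i1 i23, integral_add i2 i3, h2, h3, h4, hcross n (n + 1) le_rfl,
      hm1 _ (by omega), hm2 _ (by omega), mul_zero, zero_add]
    push_cast
    -- The bound reproduces itself exactly: `2(n+1)/((n+2)(n+3)) + 2/((n+2)(n+3)) = 2/(n+3)`.
    calc ((n : ℝ) + 1) / (n + 1 + 2) * ∫ ω, D (n + 1) ω ^ 2 ∂P +
          2 / (((n : ℝ) + 1 + 1) * (n + 1 + 2)) * ∫ ω, Y (n + 1) ω ^ 2 ∂P
        ≤ ((n : ℝ) + 1) / (n + 1 + 2) * (2 / (n + 2)) +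
          2 / (((n : ℝ) + 1 + 1) * (n + 1 + 2)) * 1 := by
          gcongr
          exact hY1 _
      _ = 2 / ((n : ℝ) + 1 + 2) := by field_simp; ring

omit [IsProbabilityMeasure P] in
-- The expectations are summable, so the series of the `f k` is almost surely finite and its terms
-- tend to zero.
theorem ae_tendsto_zero_of_integral_le {f : ℕ → Ω → ℝ} (hf : ∀ k ω, 0 ≤ f k ω)
    (hint : ∀ k, Integrable (f k) P) {C : ℝ}
    (hle : ∀ k : ℕ, ∫ ω, f k ω ∂P ≤ C * (1 / ((k : ℝ) + 1) ^ 2)) :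
    ∀ᵐ ω ∂P, Tendsto (fun k => f k ω) atTop (𝓝 0) := by
  have hsum : Summable fun k : ℕ => C * (1 / ((k : ℝ) + 1) ^ 2) := by
    refine Summable.mul_left _ ?_
    exact_mod_cast (summable_nat_add_iff 1).2 (Real.summable_one_div_nat_pow.2 one_lt_two)
  have h1 : ∫⁻ ω, ∑' k, ENNReal.ofReal (f k ω) ∂P ≠ ∞ := by
    rw [lintegral_tsum fun k => (hint k).aestronglyMeasurable.aemeasurable.ennreal_ofReal]
    refine ne_top_of_le_ne_top hsum.tsum_ofReal_ne_top (ENNReal.tsum_le_tsum fun k => ?_)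
    rw [← ofReal_integral_eq_lintegral_ofReal (hint k) (.of_forall (hf k))]
    exact ENNReal.ofReal_le_ofReal (hle k)
  filter_upwards [ae_lt_top' (AEMeasurable.tsum fun k =>
    (hint k).aestronglyMeasurable.aemeasurable.ennreal_ofReal) h1] with ω hω
  have h2 := ENNReal.tendsto_atTop_zero_of_tsum_ne_top hω.ne
  have h3 := (ENNReal.tendsto_toReal ENNReal.zero_ne_top).comp h2
  refine h3.congr fun k => ?_
  simp [ENNReal.toReal_ofReal (hf k ω)]

/-- The bound on `E D_n²` is not summable, but it is along squares. Between consecutive squares the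
path moves by at most twice the sum `T k` of the weights, and `E (T k)²` is of order `k^(-2)`. -/
theorem ae_tendsto_zero_of_integral_sq_le {V D : ℕ → Ω → ℝ} (hV : ∀ n, Measurable (V n))
    (hD : ∀ n, Measurable (D n)) (hV01 : ∀ᵐ ω ∂P, ∀ n, V n ω ∈ Set.Icc (0 : ℝ) 1)
    (hDb : ∀ᵐ ω ∂P, ∀ n, |D n ω| ≤ 1)
    (hstep : ∀ᵐ ω ∂P, ∀ n, |D (n + 1) ω - D n ω| ≤ 2 * V n ω)
    (hD2 : ∀ n : ℕ, ∫ ω, D (n + 1) ω ^ 2 ∂P ≤ 2 / ((n : ℝ) + 2))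
    (hV2 : ∀ n : ℕ, 1 ≤ n → ∫ ω, V n ω ^ 2 ∂P ≤ 2 / ((n : ℝ) + 1) ^ 2) :
    ∀ᵐ ω ∂P, Tendsto (fun n => D n ω) atTop (𝓝 0) := by
  have hDi : ∀ n, Integrable (fun ω => D n ω ^ 2) P := fun n =>
    Integrable.of_bound (by fun_prop) 1 (by
      filter_upwards [hDb] with ω h
      rw [norm_pow, Real.norm_eq_abs]
      exact pow_le_one₀ (abs_nonneg _) (h n))
  have hVi : ∀ n, Integrable (fun ω => V n ω ^ 2) P := fun n =>
    Integrable.of_bound (by fun_prop) 1 (by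
      filter_upwards [hV01] with ω h
      rw [norm_pow, Real.norm_of_nonneg (h n).1]
      exact pow_le_one₀ (h n).1 (h n).2)
  -- the squares `(k + 1) ^ 2` as a sparse subsequence
  have hsub := ae_tendsto_zero_of_integral_le (P := P) (C := 2)
    (f := fun k ω => D ((k + 1) ^ 2) ω ^ 2) (fun k ω => sq_nonneg _) (fun k => hDi _) (fun k => by
      obtain ⟨m, hm⟩ : ∃ m, (k + 1) ^ 2 = m + 1 := ⟨k ^ 2 + 2 * k, by ring⟩
      have hm' : ((k : ℝ) + 1) ^ 2 = m + 1 := by exact_mod_cast hm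
      rw [hm, hm', mul_one_div]
      refine (hD2 m).trans ?_
      gcongr
      norm_num)
  set T : ℕ → Ω → ℝ := fun k ω => ∑ j ∈ Finset.Ico ((k + 1) ^ 2) ((k + 2) ^ 2), V j ω with hT
  have hcard : ∀ k, (Finset.Ico ((k + 1) ^ 2) ((k + 2) ^ 2)).card = 2 * k + 3 := fun k => by
    rw [Nat.card_Ico]
    have : (k + 2) ^ 2 = (k + 1) ^ 2 + (2 * k + 3) := by ring
    omega
  have hblock : ∀ᵐ ω ∂P, Tendsto (fun k => ((2 * k + 3 : ℕ) : ℝ) *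
      ∑ j ∈ Finset.Ico ((k + 1) ^ 2) ((k + 2) ^ 2), V j ω ^ 2) atTop (𝓝 0) := by
    -- By Cauchy–Schwarz this quantity dominates `(T k)²`. The constant is `2 · 3²`, from `2k + 3 ≤
    -- 3(k + 1)`.
    refine ae_tendsto_zero_of_integral_le (C := 18)
      (fun k ω => mul_nonneg (by positivity) (Finset.sum_nonneg fun j _ => sq_nonneg _))
      (fun k => (integrable_finsetSum _ fun j _ => hVi j).const_mul _) fun k => ?_
    rw [integral_const_mul, integral_finsetSum _ fun j _ => hVi j]
    have h1 : ∀ j ∈ Finset.Ico ((k + 1) ^ 2) ((k + 2) ^ 2),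
        ∫ ω, V j ω ^ 2 ∂P ≤ 2 / (((k : ℝ) + 1) ^ 2) ^ 2 := fun j hj => by
      have hj1 := (Finset.mem_Ico.1 hj).1
      have hj2 : ((k : ℝ) + 1) ^ 2 ≤ j := by exact_mod_cast hj1
      refine (hV2 j (le_trans (Nat.one_le_pow _ _ (by omega)) hj1)).trans ?_
      gcongr
      linarith
    have h2 := Finset.sum_le_sum h1
    rw [Finset.sum_const, hcard, nsmul_eq_mul] at h2
    refine (mul_le_mul_of_nonneg_left h2 (by positivity)).trans ?_
    push_cast
    rw [← mul_assoc, mul_div_assoc', mul_one_div, div_le_div_iff₀ (by positivity) (by positivity)]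
    have h3 : (2 * (k : ℝ) + 3) * (2 * k + 3) * 2 ≤ 18 * ((k : ℝ) + 1) ^ 2 := by
      nlinarith [show (0 : ℝ) ≤ k by positivity]
    calc (2 * (k : ℝ) + 3) * (2 * k + 3) * 2 * ((k : ℝ) + 1) ^ 2
        ≤ 18 * ((k : ℝ) + 1) ^ 2 * ((k : ℝ) + 1) ^ 2 := by gcongr
      _ = 18 * (((k : ℝ) + 1) ^ 2) ^ 2 := by ring
  filter_upwards [hsub, hblock, hV01, hstep] with ω h1 h2 h3 h4
  have hT0 : ∀ k, 0 ≤ T k ω := fun k => Finset.sum_nonneg fun j _ => (h3 j).1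
  have hTlim : Tendsto (fun k => T k ω) atTop (𝓝 0) := by
    have h5 : Tendsto (fun k => T k ω ^ 2) atTop (𝓝 0) :=
      squeeze_zero (fun k => sq_nonneg _) (fun k => by
        have := sq_sum_le_card_mul_sum_sq (s := Finset.Ico ((k + 1) ^ 2) ((k + 2) ^ 2))
          (f := fun j => V j ω)
        rwa [hcard] at this) h2
    have h6 := h5.sqrt
    simpa [Real.sqrt_sq (hT0 _)] using h6
  have hDlim : Tendsto (fun k => |D ((k + 1) ^ 2) ω|) atTop (𝓝 0) := by
    have h6 := h1.sqrt
    simpa [Real.sqrt_sq_eq_abs] using h6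
  have hpath : ∀ m n, m ≤ n → |D n ω - D m ω| ≤ 2 * ∑ j ∈ Finset.Ico m n, V j ω := by
    intro m n hmn
    induction n, hmn using Nat.le_induction with
    | base => simp
    | succ n hmn ih =>
      rw [Finset.sum_Ico_succ_top hmn, mul_add]
      calc |D (n + 1) ω - D m ω| = |(D n ω - D m ω) + (D (n + 1) ω - D n ω)| := by ring_nf
        _ ≤ |D n ω - D m ω| + |D (n + 1) ω - D n ω| := abs_add_le _ _
        _ ≤ _ := add_le_add ih (h4 n)
  have hbound : ∀ᶠ n in atTop,
      |D n ω| ≤ |D ((n.sqrt - 1 + 1) ^ 2) ω| + 2 * T (n.sqrt - 1) ω := by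
    filter_upwards [eventually_ge_atTop 1] with n hn
    have hs : 1 ≤ n.sqrt := Nat.sqrt_pos.2 hn
    have e1 : n.sqrt - 1 + 1 = n.sqrt := by omega
    have hle : n.sqrt ^ 2 ≤ n := Nat.sqrt_le' n
    have hlt : n < (n.sqrt + 1) ^ 2 := Nat.lt_succ_sqrt' n
    have e2 : n.sqrt - 1 + 2 = n.sqrt + 1 := by omega
    have h5 := hpath _ _ hle
    have h6 : ∑ j ∈ Finset.Ico (n.sqrt ^ 2) n, V j ω ≤ T (n.sqrt - 1) ω := by
      simp only [hT, e1, e2]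
      exact Finset.sum_le_sum_of_subset_of_nonneg (Finset.Ico_subset_Ico le_rfl hlt.le)
        fun j _ _ => (h3 j).1
    rw [e1]
    have h7 := abs_sub_abs_le_abs_sub (D n ω) (D (n.sqrt ^ 2) ω)
    linarith
  have hk : Tendsto (fun n : ℕ => n.sqrt - 1) atTop atTop := by
    refine tendsto_atTop.2 fun b => ?_
    filter_upwards [eventually_ge_atTop ((b + 1) ^ 2)] with n hn
    have : b + 1 ≤ n.sqrt := Nat.le_sqrt'.2 hn
    omega
  have hlim := (hDlim.comp hk).add ((hTlim.comp hk).const_mul 2)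
  simp only [mul_zero, add_zero] at hlim
  exact squeeze_zero_norm' hbound hlim

end Recursion

/-! ### The measure-valued chain -/

section Chain

variable {Ω Θ : Type*} [MeasurableSpace Ω] [MeasurableSpace Θ]

/-- The mass that the chain gives to the set `A`. -/
noncomputable def chainMass (A : Set Θ) (w : ℕ → ℝ) (z : ℕ → Θ) : ℕ → ℝ
  | 0 => 0
  | n + 1 => w n * A.indicator 1 (z n) + (1 - w n) * chainMass A w z n

theorem measureReal_chainQ {A : Set Θ} (hA : MeasurableSet A) {w : ℕ → ℝ}
    (hw : ∀ n, w n ∈ Set.Icc (0 : ℝ) 1) (z : ℕ → Θ) (n : ℕ) :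
    (chainQ w z n : Measure Θ).real A = chainMass A w z n := by
  induction n with
  | zero => simp [chainQ, chainMass]
  | succ n ih =>
    have h1 : ((diracProba (z n)).toFiniteMeasure : Measure Θ).real A =
        A.indicator (1 : Θ → ℝ) (z n) := by
      have h2 : ((diracProba (z n)).toFiniteMeasure : Measure Θ) A = A.indicator 1 (z n) :=
        diracProba_toMeasure_apply' (z n) hA
      rw [measureReal_def, h2]
      by_cases h : z n ∈ A <;> simp [h]
    rw [chainQ, chainMass, FiniteMeasure.toMeasure_add, measureReal_add_apply,
      FiniteMeasure.toMeasure_smul, FiniteMeasure.toMeasure_smul, measureReal_nnreal_smul_apply,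
      measureReal_nnreal_smul_apply, h1, ih, Real.coe_toNNReal _ (hw n).1,
      Real.coe_toNNReal _ (by linarith [(hw n).2])]

omit [MeasurableSpace Θ] in
theorem chainMass_mem_Icc (A : Set Θ) {w : ℕ → ℝ} (hw : ∀ n, w n ∈ Set.Icc (0 : ℝ) 1)
    (z : ℕ → Θ) (n : ℕ) : chainMass A w z n ∈ Set.Icc (0 : ℝ) 1 := by
  induction n with
  | zero => simp [chainMass]
  | succ n ih =>
    have h1 := hw n
    have h2 : A.indicator (1 : Θ → ℝ) (z n) ∈ Set.Icc (0 : ℝ) 1 := indicator_one_mem_Icc A _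
    have h3 : (0 : ℝ) ≤ 1 - w n := by linarith [h1.2]
    refine ⟨add_nonneg (mul_nonneg h1.1 h2.1) (mul_nonneg h3 ih.1), ?_⟩
    calc w n * A.indicator (1 : Θ → ℝ) (z n) + (1 - w n) * chainMass A w z n
        ≤ w n * 1 + (1 - w n) * 1 :=
          add_le_add (mul_le_mul_of_nonneg_left h2.2 h1.1) (mul_le_mul_of_nonneg_left ih.2 h3)
      _ = 1 := by ring

theorem measureReal_chainQ_univ_le {w : ℕ → ℝ} (hw : ∀ n, w n ∈ Set.Icc (0 : ℝ) 1) (z : ℕ → Θ)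
    (n : ℕ) : (chainQ w z n : Measure Θ).real Set.univ ≤ 1 := by
  rw [measureReal_chainQ .univ hw]
  exact (chainMass_mem_Icc _ hw z n).2

theorem isProbabilityMeasure_chainQ_succ {w : ℕ → ℝ} (hw : ∀ n, w n ∈ Set.Icc (0 : ℝ) 1)
    (h0 : w 0 = 1) (z : ℕ → Θ) (n : ℕ) :
    IsProbabilityMeasure (chainQ w z (n + 1) : Measure Θ) := by
  have h1 : chainMass Set.univ w z (n + 1) = 1 := by
    induction n with
    | zero => simp [chainMass, h0]
    | succ n ih => rw [chainMass, ih]; simp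
  rw [← measureReal_chainQ .univ hw, measureReal_def] at h1
  exact ⟨(ENNReal.toReal_eq_one_iff _).1 h1⟩

/-- The chain at time `n` sees only the weights with index below `n`, which makes `W n` independent
of it. -/
theorem exists_measurable_chainMass {A : Set Θ} (hA : MeasurableSet A) (n : ℕ) :
    ∃ Φ : (Finset.range n → ℝ) × (ℕ → Θ) → ℝ, Measurable Φ ∧
      ∀ w z, chainMass A w z n = Φ (fun i => w i, z) := by
  induction n with
  | zero => exact ⟨fun _ => 0, measurable_const, fun _ _ => rfl⟩
  | succ n ih =>
    obtain ⟨Φ, hΦ, h⟩ := ih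
    have hsub : Finset.range n ⊆ Finset.range (n + 1) :=
      Finset.range_subset_range.2 n.le_succ
    have hI : Measurable fun z : ℕ → Θ => A.indicator (1 : Θ → ℝ) (z n) :=
      (measurable_one.indicator hA).comp (measurable_pi_apply n)
    refine ⟨fun p => p.1 ⟨n, Finset.self_mem_range_succ n⟩ * A.indicator 1 (p.2 n) +
      (1 - p.1 ⟨n, Finset.self_mem_range_succ n⟩) * Φ (fun i => p.1 ⟨i, hsub i.2⟩, p.2), ?_,
      fun w z => ?_⟩
    · have h1 : Measurable fun p : (Finset.range (n + 1) → ℝ) × (ℕ → Θ) =>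
          A.indicator (1 : Θ → ℝ) (p.2 n) := hI.comp measurable_snd
      have h2 : Measurable fun p : (Finset.range (n + 1) → ℝ) × (ℕ → Θ) =>
          Φ (fun i : Finset.range n => p.1 ⟨i, hsub i.2⟩, p.2) := hΦ.comp (by fun_prop)
      fun_prop
    · rw [chainMass, h]

variable {P : Measure Ω} {W : ℕ → Ω → ℝ} {Z : ℕ → Ω → Θ}

theorem IsChainWeights.ae_mem_Icc (hW : IsChainWeights P W) :
    ∀ᵐ ω ∂P, ∀ n, W n ω ∈ Set.Icc (0 : ℝ) 1 := by
  refine ae_all_iff.2 fun n => ?_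
  rcases n.eq_zero_or_pos with rfl | hn
  · filter_upwards [hW.first] with ω h
    simp [h]
  · have h := ae_betaMeasure_mem_Ioo 1 n
    rw [← hW.beta n hn] at h
    filter_upwards [ae_of_ae_map (hW.measurable n).aemeasurable h] with ω h
    exact ⟨h.1.le, h.2.le⟩

theorem IsChainWeights.indepFun_past [IsProbabilityMeasure P] (hW : IsChainWeights P W)
    (hm : ∀ n, Measurable (Z n)) (hWZ : IndepFun (fun ω n => W n ω) (fun ω n => Z n ω) P) (n : ℕ) :
    IndepFun (W n) (fun ω => ((fun i : Finset.range n => W i ω), fun m => Z m ω)) P := by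
  have hWm := hW.measurable
  refine indepFun_prodMk_of_indepFun_prodMk (hWm n) (by fun_prop) (by fun_prop) ?_ ?_
  · have h := hW.indep.indepFun_finset {n} (Finset.range n) (by simp) hWm
    exact h.comp (φ := fun v : ({n} : Finset ℕ) → ℝ => v ⟨n, Finset.mem_singleton_self n⟩)
      (measurable_pi_apply _) measurable_id
  · exact hWZ.comp (φ := fun w : ℕ → ℝ => (w n, fun i : Finset.range n => w i)) (by fun_prop)
      measurable_id

/-- The error depends through `q` on all of `Z`, future terms included, so the recursion needs `W n`
independent of the earlier weights jointly with the entire sequence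
(`IsChainWeights.indepFun_past`). -/
theorem ae_tendsto_chainMass [IsProbabilityMeasure P] (hW : IsChainWeights P W)
    (hm : ∀ n, Measurable (Z n)) (hWZ : IndepFun (fun ω n => W n ω) (fun ω n => Z n ω) P)
    {q : (ℕ → Θ) → ProbabilityMeasure Θ} (hq : Measurable q) {A : Set Θ} (hA : MeasurableSet A)
    (horth : ∀ i j, i ≠ j →
      ∫ ω, (A.indicator 1 (Z i ω) - (q (fun n => Z n ω) : Measure Θ).real A) *
        (A.indicator 1 (Z j ω) - (q (fun n => Z n ω) : Measure Θ).real A) ∂P = 0) :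
    ∀ᵐ ω ∂P, Tendsto (fun n => chainMass A (fun i => W i ω) (fun i => Z i ω) n) atTop
      (𝓝 ((q fun n => Z n ω : Measure Θ).real A)) := by
  have hWm := hW.measurable
  have hζ : Measurable fun ω n => Z n ω := by fun_prop
  have hqA : Measurable fun z => (q z : Measure Θ).real A :=
    ((Measure.measurable_coe hA).comp (measurable_subtype_coe.comp hq)).ennreal_toReal
  have hqA01 : ∀ z, (q z : Measure Θ).real A ∈ Set.Icc (0 : ℝ) 1 := fun z =>
    ⟨measureReal_nonneg, measureReal_le_one⟩
  have hI : ∀ m, Measurable fun z : ℕ → Θ => A.indicator (1 : Θ → ℝ) (z m) := fun m =>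
    (measurable_one.indicator hA).comp (measurable_pi_apply m)
  have hI01 := indicator_one_mem_Icc A
  set Y : ℕ → Ω → ℝ := fun n ω =>
    A.indicator 1 (Z n ω) - (q (fun n => Z n ω) : Measure Θ).real A with hY
  set D : ℕ → Ω → ℝ := fun n ω => chainMass A (fun i => W i ω) (fun i => Z i ω) n -
    (q (fun n => Z n ω) : Measure Θ).real A with hD
  have hYm : ∀ n, Measurable (Y n) := fun n => ((hI n).sub hqA).comp hζ
  have hind : ∀ n, Measurable (D n) ∧ IndepFun (W n) (fun ω => (D n ω, fun m => Y m ω)) P := by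
    intro n
    obtain ⟨Φ, hΦ, h⟩ := exists_measurable_chainMass hA n
    constructor
    · simp only [hD, h]
      exact (hΦ.comp (by fun_prop)).sub (hqA.comp hζ)
    · have h1 := (hW.indepFun_past hm hWZ n).comp (φ := id)
        (ψ := fun p : (Finset.range n → ℝ) × (ℕ → Θ) =>
          (Φ p - (q p.2 : Measure Θ).real A,
            fun m => A.indicator (1 : Θ → ℝ) (p.2 m) - (q p.2 : Measure Θ).real A))
        measurable_id
        ((hΦ.sub (hqA.comp measurable_snd)).prodMk (measurable_pi_lambda _ fun m =>
          ((hI m).sub hqA).comp measurable_snd))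
      simp only [hD, h]
      exact h1
  have hYb : ∀ n ω, |Y n ω| ≤ 1 := fun n ω => by
    have h1 := hI01 (Z n ω)
    have h2 := hqA01 (fun n => Z n ω)
    rw [abs_le]; constructor <;> simp only [hY] <;> linarith [h1.1, h1.2, h2.1, h2.2]
  have hDb : ∀ᵐ ω ∂P, ∀ n, |D n ω| ≤ 1 := by
    filter_upwards [hW.ae_mem_Icc] with ω hω n
    have h1 := chainMass_mem_Icc A hω (fun i => Z i ω) n
    have h2 := hqA01 (fun n => Z n ω)
    rw [abs_le]; constructor <;> simp only [hD] <;> linarith [h1.1, h1.2, h2.1, h2.2]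
  have hrec : ∀ n ω, D (n + 1) ω = (1 - W n ω) * D n ω + W n ω * Y n ω := fun n ω => by
    simp only [hD, hY, chainMass]; ring
  have hV2 : ∀ n : ℕ, 1 ≤ n → ∫ ω, W n ω ^ 2 ∂P = 2 / (((n : ℝ) + 1) * (n + 2)) := fun n hn => by
    rw [← integral_sq_betaMeasure_one (by exact_mod_cast hn), ← hW.beta n hn,
      integral_map (hWm n).aemeasurable (by fun_prop)]
  have hD2 := integral_sq_le_of_recursion hWm hYm (fun n => (hind n).1) hW.ae_mem_Icc hW.first hYb
    hDb hrec (fun n => (hind n).2) horth hV2 (fun n hn => by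
      rw [← integral_one_sub_sq_betaMeasure_one (by exact_mod_cast hn), ← hW.beta n hn,
        integral_map (hWm n).aemeasurable (by fun_prop)])
  have hlim := ae_tendsto_zero_of_integral_sq_le hWm (fun n => (hind n).1) hW.ae_mem_Icc hDb
    (by
      filter_upwards [hW.ae_mem_Icc, hDb] with ω h1 h2 n
      rw [hrec, show (1 - W n ω) * D n ω + W n ω * Y n ω - D n ω = W n ω * (Y n ω - D n ω) by ring,
        abs_mul, abs_of_nonneg (h1 n).1, mul_comm]
      refine mul_le_mul_of_nonneg_right ((abs_sub _ _).trans ?_) (h1 n).1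
      linarith [hYb n ω, h2 n]) hD2 (fun n hn => by
      rw [hV2 n hn]
      gcongr
      nlinarith [show (0 : ℝ) ≤ n by positivity])
  filter_upwards [hlim] with ω h
  have h1 := h.add_const ((q (fun n => Z n ω) : Measure Θ).real A)
  simpa [hD] using h1

/-- Countability allows a single null set for all test sets; closure under intersection and local
fineness make convergence on them imply weak convergence. -/
theorem exists_countable_isPiSystem_nhds (Θ : Type*) [TopologicalSpace Θ]
    [SecondCountableTopology Θ] : ∃ S : Set (Set Θ), S.Countable ∧ IsPiSystem S ∧
      (∀ s ∈ S, IsOpen s) ∧ ∀ u : Set Θ, IsOpen u → ∀ x ∈ u, ∃ s ∈ S, s ∈ 𝓝 x ∧ s ⊆ u := by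
  obtain ⟨b, hbc, -, hb⟩ := TopologicalSpace.exists_countable_basis Θ
  refine ⟨Set.sInter '' {f | f.Finite ∧ f ⊆ b}, (Set.countable_ofPred_finite_subset hbc).image _,
    ?_, ?_, fun u hu x hx => ?_⟩
  · rintro _ ⟨f, hf, rfl⟩ _ ⟨g, hg, rfl⟩ -
    exact ⟨f ∪ g, ⟨hf.1.union hg.1, Set.union_subset hf.2 hg.2⟩, Set.sInter_union f g⟩
  · rintro _ ⟨f, hf, rfl⟩
    exact hf.1.isOpen_sInter fun s hs => hb.isOpen (hf.2 hs)
  · obtain ⟨v, hv, hxv, hvu⟩ := hb.exists_subset_of_mem_open hx hu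
    exact ⟨v, ⟨{v}, ⟨Set.finite_singleton v, by simpa using hv⟩, Set.sInter_singleton v⟩,
      (hb.isOpen hv).mem_nhds hxv, hvu⟩

theorem isWeakLimit_of_orthogonal [TopologicalSpace Θ] [SecondCountableTopology Θ]
    [OpensMeasurableSpace Θ] [IsProbabilityMeasure P]
    (hW : IsChainWeights P W) (hm : ∀ n, Measurable (Z n))
    (hWZ : IndepFun (fun ω n => W n ω) (fun ω n => Z n ω) P)
    {q : (ℕ → Θ) → ProbabilityMeasure Θ} (hq : Measurable q)
    (horth : ∀ A : Set Θ, MeasurableSet A → ∀ i j, i ≠ j →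
      ∫ ω, (A.indicator 1 (Z i ω) - (q (fun n => Z n ω) : Measure Θ).real A) *
        (A.indicator 1 (Z j ω) - (q (fun n => Z n ω) : Measure Θ).real A) ∂P = 0) :
    IsWeakLimit P W Z fun ω => q fun n => Z n ω := by
  refine ⟨hq.comp (by fun_prop), ?_⟩
  obtain ⟨S, hSc, hSpi, hSo, hSn⟩ := exists_countable_isPiSystem_nhds Θ
  have hall : ∀ᵐ ω ∂P, ∀ s ∈ S,
      Tendsto (fun n => chainMass s (fun i => W i ω) (fun i => Z i ω) n) atTop
        (𝓝 ((q fun n => Z n ω : Measure Θ).real s)) :=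
    (ae_ball_iff hSc).2 fun s hs => ae_tendsto_chainMass hW hm hWZ hq (hSo s hs).measurableSet
      (horth s (hSo s hs).measurableSet)
  filter_upwards [hall, hW.ae_mem_Icc, hW.first] with ω h1 h2 h3
  -- The shift skips time `0`, where the chain is the zero measure.
  let p : ℕ → ProbabilityMeasure Θ := fun n => ⟨chainQ (fun i => W i ω) (fun i => Z i ω) (n + 1),
    isProbabilityMeasure_chainQ_succ h2 h3 _ n⟩
  have hp : Tendsto p atTop (𝓝 (q fun n => Z n ω)) := by
    refine hSpi.tendsto_probabilityMeasure_of_tendsto_of_mem (fun s hs => (hSo s hs).measurableSet)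
      hSn fun s hs => ?_
    rw [← NNReal.tendsto_coe]
    refine ((tendsto_add_atTop_iff_nat 1).2 (h1 s hs)).congr fun n => ?_
    rw [← measureReal_chainQ (hSo s hs).measurableSet h2]
    rfl
  refine (tendsto_add_atTop_iff_nat 1).1 ?_
  exact (ProbabilityMeasure.tendsto_nhds_iff_toFiniteMeasure_tendsto_nhds atTop).1 hp

end Chain

/-! ### Mixtures of density kernels -/

section Mixture

variable {X Θ : Type*} [MeasurableSpace X] [MeasurableSpace Θ] {μ : Measure X} {k : X → Θ → ℝ}
  {h : X → ℝ}

omit [MeasurableSpace X] in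
theorem abs_mixture_le (hk : ∀ x θ, 0 ≤ k x θ) (hbound : ∀ x θ, k x θ ≤ h x) (ν : Measure Θ)
    [IsFiniteMeasure ν] (hν : ν.real Set.univ ≤ 1) (x : X) : |mixture k ν x| ≤ |h x| := by
  have h1 : ‖mixture k ν x‖ ≤ |h x| * ν.real Set.univ :=
    norm_integral_le_of_norm_le_const (.of_forall fun θ => by
      rw [Real.norm_of_nonneg (hk x θ)]
      exact (hbound x θ).trans (le_abs_self _))
  exact h1.trans (mul_le_of_le_one_right (abs_nonneg _) hν)

theorem integrable_mixture (hk : IsDensityKernel μ k) (hint : Integrable h μ)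
    (hbound : ∀ x θ, k x θ ≤ h x) (ν : Measure Θ) [IsFiniteMeasure ν]
    (hν : ν.real Set.univ ≤ 1) : Integrable (mixture k ν) μ :=
  Integrable.mono hint
    (StronglyMeasurable.integral_prod_right hk.measurable.stronglyMeasurable).aestronglyMeasurable
    (.of_forall fun x => abs_mixture_le hk.nonneg hbound ν hν x)

theorem tendsto_integral_abs_mixture_sub [TopologicalSpace Θ] [OpensMeasurableSpace Θ]
    (hk : IsDensityKernel μ k) (hcont : ∀ x, Continuous (k x)) (hint : Integrable h μ)
    (hbound : ∀ x θ, k x θ ≤ h x) {q : ℕ → FiniteMeasure Θ} {ν : FiniteMeasure Θ}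
    (hq : ∀ n, (q n : Measure Θ).real Set.univ ≤ 1) (hν : (ν : Measure Θ).real Set.univ ≤ 1)
    (hlim : Tendsto q atTop (𝓝 ν)) :
    Tendsto (fun n => ∫ x, |mixture k (q n : Measure Θ) x - mixture k (ν : Measure Θ) x| ∂μ)
      atTop (𝓝 0) := by
  have hpt : ∀ x, Tendsto (fun n => mixture k (q n : Measure Θ) x) atTop
      (𝓝 (mixture k (ν : Measure Θ) x)) := fun x =>
    FiniteMeasure.tendsto_iff_forall_integral_tendsto.1 hlim
      (BoundedContinuousFunction.ofNormedAddCommGroup (k x) (hcont x) (h x) fun θ => by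
        rw [Real.norm_of_nonneg (hk.nonneg x θ)]
        exact hbound x θ)
  have hdct := tendsto_integral_of_dominated_convergence (μ := μ)
    (F := fun n x => |mixture k (q n : Measure Θ) x - mixture k (ν : Measure Θ) x|)
    (f := fun _ => 0) (fun x => |h x| + |h x|)
    (fun n => ((integrable_mixture hk hint hbound _ (hq n)).sub
      (integrable_mixture hk hint hbound _ hν)).abs.aestronglyMeasurable)
    (hint.abs.add hint.abs)
    (fun n => .of_forall fun x => by
      rw [Real.norm_eq_abs, abs_abs]
      exact (abs_sub _ _).trans (add_le_add (abs_mixture_le hk.nonneg hbound _ (hq n) x)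
        (abs_mixture_le hk.nonneg hbound _ hν x)))
    (.of_forall fun x => by
      simpa using ((hpt x).sub_const (mixture k (ν : Measure Θ) x)).abs)
  simpa using hdct

end Mixture

theorem theorem2
    {Ω X Θ : Type*} [MeasurableSpace Ω]
    [TopologicalSpace X] [PolishSpace X] [MeasurableSpace X] [BorelSpace X]
    [TopologicalSpace Θ] [PolishSpace Θ] [MeasurableSpace Θ] [BorelSpace Θ]
    (P : Measure Ω) [IsProbabilityMeasure P]
    (W : ℕ → Ω → ℝ) (hW : IsChainWeights P W)
    (Z : ℕ → Ω → Θ) (hZmeas : ∀ n, Measurable (Z n)) (hZ : Exchangeable P Z)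
    (hWZ : IndepFun (fun ω n => W n ω) (fun ω n => Z n ω) P)
    (μ : Measure X) [SigmaFinite μ]
    (k : X → Θ → ℝ) (hk : IsDensityKernel μ k)
    (hcont : ∀ x, Continuous (k x))
    (h : X → ℝ) (hint : Integrable h μ) (hbound : ∀ x θ, k x θ ≤ h x) :
    (∃ Q : Ω → ProbabilityMeasure Θ,
        IsWeakLimit P W Z Q ∧ IsDeFinettiMeasure P Z (P.map Q)) ∧
      ∀ Q : Ω → ProbabilityMeasure Θ, IsWeakLimit P W Z Q →
        ∀ᵐ ω ∂P,
          (∀ n, Integrable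
            (mixture k (chainQ (fun i => W i ω) (fun i => Z i ω) n : Measure Θ)) μ) ∧
          Integrable (mixture k (Q ω : Measure Θ)) μ ∧
          Tendsto
            (fun n => ∫ x,
              |mixture k (chainQ (fun i => W i ω) (fun i => Z i ω) n : Measure Θ) x
                - mixture k (Q ω : Measure Θ) x| ∂μ)
            atTop (𝓝 0) := by
  have hΩ : Nonempty Ω := nonempty_of_isProbabilityMeasure P
  have hΘ : Nonempty Θ := hΩ.map (Z 0)
  constructor
  -- The same `q` is the weak limit and directs the sequence, so its law is the de Finetti measure.
  · obtain ⟨q, hq, horth⟩ := hZ.exists_directing hZmeas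
    exact ⟨fun ω => q fun n => Z n ω, isWeakLimit_of_orthogonal hW hZmeas hWZ hq horth,
      hZ.isDeFinettiMeasure_map hZmeas (hq.comp (by fun_prop)) horth⟩
  · rintro Q ⟨-, hQ⟩
    filter_upwards [hQ, hW.ae_mem_Icc] with ω h1 h2
    have hmass := measureReal_chainQ_univ_le h2 fun i => Z i ω
    have hmassQ : (Q ω : Measure Θ).real Set.univ ≤ 1 := measureReal_le_one
    exact ⟨fun n => integrable_mixture hk hint hbound _ (hmass n),
      integrable_mixture hk hint hbound _ hmassQ,
      tendsto_integral_abs_mixture_sub (ν := (Q ω).toFiniteMeasure) hk hcont hint hbound hmass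
        hmassQ h1⟩
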